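/- Let $K$ be a field, $E: y^2+a_1xy+a_3y=x^3+a_2x^2+a_4x+a_6$ an elliptic curve over $K$ with point at infinity $O$, $T\in K[t]$ an irreducible separable polynomial of degree $d$, $L=K[t]/(T)=K(\theta)$ with $\theta$ the class of $t$, and $x_P,y_P\in K[t]$ polynomials of degree $<d$ such that $P=(x_P(\theta),y_P(\theta))\in E(L)$. For a finite extension $F/K$ and $P\in E(F)$, the trace $\operatorname{Tr}^F_K P$ is the point $S\in E(K)$ whose image in $E(\Omega)$, for an algebraic closure $\Omega$ of $K$, is $[F:K]_{\rm ins}\sum_{j\in\operatorname{Hom}_K(F,\Omega)}P^j$. A kernel matrix in echelon form of a matrix $M$ over $K$ is a matrix whose columns are a basis of the right kernel of $M$ and such that the number of consecutive zeros at the bottom of the $j$-th column is a strictly decreasing function of $j$. There is a subroutine returning such a matrix for every $M$; fix any one. Consider the following algorithm. If $x_P$ and $y_P$ are both constant, return $[d]P$; if $x_P$ is constant and $y_P$ is not, return $O$. Otherwise let $\mathcal L_1=1$, $\mathcal L_2=x_P(\theta)$, $\mathcal L_3=y_P(\theta)$, $\mathcal L_j=x_P(\theta)\mathcal L_{j-2}$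 for $4\le j\le d+1$; let $M$ be the $d\times(d+1)$ matrix whose $j$-th column consists of the coordinates of $\mathcal L_j$ on $1,\theta,\dots,\theta^{d-1}$, and let $Z$ be the leftmost column of the kernel matrix of $M$ in echelon form. Put $$U=Z_1+\sum_{j=1}^{\lfloor (d+1)/2\rfloor}Z_{2j}x^j,\qquad V=\sum_{j=0}^{\lfloor (d-2)/2\rfloor}Z_{2j+3}x^j .$$ If $V=0$, return $O$. Let $X$ be the minimal polynomial of $x_P(\theta)$ over $K$, $R=(x^3+a_2x^2+a_4x+a_6)V^2+(a_1x+a_3)UV-U^2$ and $S=R/X$. If $\deg S=0$, return $O$. Otherwise let $x_Q$ be the unique root of $S$, $y_Q=-U(x_Q)/V(x_Q)$, $Q=(x_Q,y_Q)$, let $d_P$ be the largest $j\le d$ with $Z_{j+1}\ne0$, and return $[-d/d_P]Q$. Then all the steps of this algorithm are possible (the kernel matrix has a first column, $X$ divides $R$, the root $x_Q$ exists and is unique, $V(x_Q)\neq0$, $(x_Q,y_Q)\in E(K)$, $d_P\mid d$), and it returns $\operatorname{Tr}^{L}_K P$. Moreover, suppose that $x_P$ is not constant, and let $K(P)=K(x_P(\theta),y_P(\theta))$,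 $\delta=[K(P):K]$ and $Q_0=-\operatorname{Tr}^{K(P)}_K P\in E(K)$. Then $\delta\mid d$ and the value returned is $[-d/\delta]Q_0$. The function $f_P=U(x)+V(x)y$ is nonzero, lies in the Riemann–Roch space $L((d+1)O)$, and vanishes at all the conjugates of $P$. It has minimal degree among the nonzero functions on $E$, defined over $K$ and without pole outside $O$, that vanish at all the conjugates of $P$, and any such function of the same degree is a scalar multiple of $f_P$; its degree is $\delta+1$ if $Q_0\ne O$ and $\delta$ if $Q_0=O$. One has $R=-f_P\cdot(f_P\circ[-1])$. If $V=0$, then $Q_0=O$. If $V\ne0$, then $X$ divides $R$, and $S=R/X$ is a nonzero constant if and only if $Q_0=O$. If $V\neq 0$ and $Q_0\ne O$, then $S$ has degree $1$, $d_P=\delta$, and $Q=Q_0$. -/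

import Mathlib

open Polynomial
open scoped Classical WeierstrassCurve.Affine

namespace EllTrace

universe u v w

/-! ### Points of an elliptic curve over extension fields, and the trace

For a Weierstrass curve `W` over `K` and an extension `F` of `K`, the group `E(F)` is
`(W⁄F).Point`. A `K`-embedding `j : L →ₐ[K] F` induces `P ↦ P ^ j`, which is
`WeierstrassCurve.Affine.Point.map j`. -/

instance isElliptic_baseChange {K : Type u} [Field K] (W : WeierstrassCurve.Affine K)
    [W.IsElliptic] (F : Type v) [Field F] [Algebra K F] : (W⁄F).IsElliptic :=
  inferInstanceAs (WeierstrassCurve.map W (algebraMap K F)).IsElliptic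

section Trace

variable {K : Type u} [Field K] (W : WeierstrassCurve.Affine K)

/-- `IsTrace W L Ω P S` says that `S ∈ E(K)` is the trace of `P ∈ E(L)` for the finite extension
`L / K`: over the algebraic closure `Ω` of `K` (whose structure embedding `i : K → Ω` is arbitrary),
`S ^ i = [L : K]_ins • ∑ j, P ^ j`, where `j` ranges over the finitely many embeddings of `L`
into `Ω` extending `i`. Since `S ↦ S ^ i` is injective, `S` is determined by this. -/
def IsTrace (L : Type v) [Field L] [Algebra K L] (Ω : Type w) [Field Ω] [Algebra K Ω]
    (P : (W⁄L).Point) (S : (W⁄K).Point) : Prop :=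
  WeierstrassCurve.Affine.Point.map (W' := W) (Algebra.ofId K Ω) S =
    Field.finInsepDegree K L • ∑ᶠ j : L →ₐ[K] Ω, WeierstrassCurve.Affine.Point.map (W' := W) j P

end Trace

/-! ### Functions on the curve whose only pole is the point at infinity

These are the elements `U(x) + V(x) y` of the affine coordinate ring `K[E]`. -/

section Functions

variable {K : Type u} [Field K] (W : WeierstrassCurve.Affine K)

/-- The function `U(x) + V(x) y`. -/
noncomputable def ofUV (U V : K[X]) : W.CoordinateRing :=
  WeierstrassCurve.Affine.CoordinateRing.mk W (C U + C V * X)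

/-- Evaluation of a function at an affine point `(x, y)` of `E(F)`. -/
noncomputable def evalAt {F : Type v} [Field F] [Algebra K F] {x y : F} (h : (W⁄F).Equation x y) :
    W.CoordinateRing →+* F :=
  AdjoinRoot.lift (eval₂RingHom (algebraMap K F) x) y (by
    have h' := ((W⁄F).equation_iff x y).1 h
    simp only [WeierstrassCurve.Affine.polynomial, WeierstrassCurve.baseChange,
      WeierstrassCurve.map_a₁, WeierstrassCurve.map_a₂, WeierstrassCurve.map_a₃,
      WeierstrassCurve.map_a₄, WeierstrassCurve.map_a₆] at h' ⊢
    simp [eval₂_add, eval₂_sub, eval₂_mul, eval₂_pow]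
    linear_combination h')

/-- `f` vanishes at the point `P` of `E(F)`. A nonzero function without affine pole is either a
nonzero constant or has a pole at the point at infinity, hence never vanishes there. -/
def VanishesAt {F : Type v} [Field F] [Algebra K F] (f : W.CoordinateRing) :
    (W⁄F).Point → Prop
  | .zero => f = 0
  | .some _ _ h => evalAt W h.1 f = 0

/-- The pullback `f ↦ f ∘ [-1]`, that is `x ↦ x`, `y ↦ -y - a₁ x - a₃`. -/
noncomputable def compNeg : W.CoordinateRing →ₐ[K[X]] W.CoordinateRing :=
  AdjoinRoot.liftAlgHom W.polynomial (Algebra.ofId K[X] W.CoordinateRing)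
    (WeierstrassCurve.Affine.CoordinateRing.mk W W.negPolynomial) (by
      have h : W.polynomial.eval₂ (C : K[X] →+* K[X][X]) W.negPolynomial = W.polynomial := by
        simp only [WeierstrassCurve.Affine.polynomial, WeierstrassCurve.Affine.negPolynomial]
        simp [eval₂_add, eval₂_sub, eval₂_mul, eval₂_pow]
        ring
      have h2 := congrArg (WeierstrassCurve.Affine.CoordinateRing.mk W) h
      rw [hom_eval₂] at h2
      rw [show WeierstrassCurve.Affine.CoordinateRing.mk W W.polynomial = 0 from
        AdjoinRoot.mk_self] at h2
      exact h2)

/-- The order of the pole at infinity of a nonzero function `f` without affine pole. The functions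
`f` and `f ∘ [-1]` have poles of the same order, and their product is the norm of `f`, a polynomial
in `x`, where `x` has a double pole; so this order is the degree in `x` of the norm. It is
also the number of zeros of `f`, counted with multiplicities, that is, the degree of `f`. -/
noncomputable def functionDegree (f : W.CoordinateRing) : ℕ :=
  (Algebra.norm K[X] f).natDegree

/-- The Riemann–Roch space of the divisor `n O`. -/
def riemannRochSpace (n : ℕ) : Set W.CoordinateRing :=
  {f | f = 0 ∨ functionDegree W f ≤ n}

end Functions

/-! ### Kernel matrices in echelon form -/

section Kernel

variable {K : Type u} [Field K]

/-- The number of consecutive zeros at the bottom of a column. -/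
noncomputable def trailingZeros {n : ℕ} (v : Fin n → K) : ℕ :=
  (Finset.univ.filter fun i : Fin n => ∀ k, i ≤ k → v k = 0).card

/-- The columns of `Z` are a basis of the right kernel of `M`, and the number of consecutive zeros
at the bottom of the `j`-th column is a strictly decreasing function of `j`. -/
structure IsEchelonKernelMatrix {m n r : ℕ} (M : Matrix (Fin m) (Fin n) K)
    (Z : Matrix (Fin n) (Fin r) K) : Prop where
  linearIndependent : LinearIndependent K Z.col
  span_eq_ker : Submodule.span K (Set.range Z.col) = LinearMap.ker M.mulVecLin
  strictAnti : StrictAnti fun j => trailingZeros (Z.col j)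

/-- A subroutine that takes a matrix and returns a matrix with as many rows as the input has
columns, together with its number of columns. -/
abbrev KernelRoutine (K : Type u) : Type u :=
  ∀ m n : ℕ, Matrix (Fin m) (Fin n) K → Σ r : ℕ, Matrix (Fin n) (Fin r) K

/-- The subroutine always returns a kernel matrix in echelon form. -/
def KernelRoutine.IsCorrect (kernel : KernelRoutine K) : Prop :=
  ∀ (m n : ℕ) (M : Matrix (Fin m) (Fin n) K), IsEchelonKernelMatrix M (kernel m n M).2

end Kernel

/-! ### The algorithm -/

section Algorithm

variable {K : Type u} [Field K]

/-- The list `1, x, y, x * 1, x * y, …`, in which each entry from the fourth on is `x` times the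
entry two places earlier; indices start at `0`. -/
def values {A : Type v} [Mul A] [One A] (x y : A) : ℕ → A
  | 0 => 1
  | 1 => x
  | 2 => y
  | n + 3 => x * values x y (n + 1)

/-- The `d × (d + 1)` matrix, `d = deg T`, whose columns are the coefficients of the first
`d + 1` entries of `values` with respect to the basis `1, θ, …, θ ^ (d - 1)` of `K[t] / T(t)`. -/
noncomputable def valueMatrix (T : K[X]) [hT : Fact (Irreducible T)] (xP yP : K[X]) :
    Matrix (Fin T.natDegree) (Fin (T.natDegree + 1)) K :=
  Matrix.of fun i j =>
    (AdjoinRoot.powerBasisAux hT.out.ne_zero).repr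
      (values (AdjoinRoot.mk T xP) (AdjoinRoot.mk T yP) j) i

/-- The `k`-th entry `Z[k]` of a column, with indices starting at `1`. -/
def entry {n : ℕ} (Z : Fin n → K) (k : ℕ) : K :=
  if h : 1 ≤ k ∧ k ≤ n then Z ⟨k - 1, by omega⟩ else 0

/-- `U = Z[1] + ∑_{1 ≤ j ≤ ⌊(d+1)/2⌋} Z[2j] x ^ j`. -/
noncomputable def polyU {d : ℕ} (Z : Fin (d + 1) → K) : K[X] :=
  C (entry Z 1) + ∑ j ∈ Finset.Icc 1 ((d + 1) / 2), C (entry Z (2 * j)) * X ^ j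

/-- `V = ∑_{0 ≤ j ≤ ⌊(d-2)/2⌋} Z[2j+3] x ^ j`. -/
noncomputable def polyV {d : ℕ} (Z : Fin (d + 1) → K) : K[X] :=
  ∑ j ∈ Finset.range (d / 2), C (entry Z (2 * j + 3)) * X ^ j

/-- `R = (x³ + a₂ x² + a₄ x + a₆) V² + (a₁ x + a₃) U V - U²`. -/
noncomputable def polyR (W : WeierstrassCurve.Affine K) (U V : K[X]) : K[X] :=
  (X ^ 3 + C W.a₂ * X ^ 2 + C W.a₄ * X + C W.a₆) * V ^ 2 + (C W.a₁ * X + C W.a₃) * U * V - U ^ 2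

/-- The largest `j ≤ d` such that `Z[j+1] ≠ 0`. -/
noncomputable def lastIndex {d : ℕ} (Z : Fin (d + 1) → K) : ℕ :=
  Nat.findGreatest (fun j => entry Z (j + 1) ≠ 0) d

/-- The leftmost column of a matrix; `none` if there is no column. -/
def leftmostColumn {n : ℕ} (Z : Σ r : ℕ, Matrix (Fin n) (Fin r) K) : Option (Fin n → K) :=
  if h : 0 < Z.1 then some (Z.2.col ⟨0, h⟩) else none

/-- The point `(x, y)` of `E(K)`; `none` if `(x, y)` does not lie on the curve. -/
noncomputable def affinePoint (W : WeierstrassCurve.Affine K) [W.IsElliptic] (x y : K) :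
    Option (W⁄K).Point :=
  if h : (W⁄K).Equation x y then some (WeierstrassCurve.Affine.Point.mk h) else none

/-- The last part of the algorithm, run on the leftmost column `Z` of the kernel matrix and the
minimal polynomial `m` of the `x`-coordinate. It fails (returns `none`) as soon as a step is
impossible: a division is not exact, a divisor is zero, a root does not exist or is not unique, or
the pair found is not a point of the curve. -/
noncomputable def finish (W : WeierstrassCurve.Affine K) [W.IsElliptic] {d : ℕ}
    (Z : Fin (d + 1) → K) (m : K[X]) : Option (W⁄K).Point :=
  let U := polyU Z
  let V := polyV Z
  if V = 0 then some 0
  else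
    let R := polyR W U V
    if m ∣ R then
      let S := R / m
      if S.degree = 0 then some 0
      else if hS : ∃! x, S.IsRoot x then
        let xQ := hS.choose
        if V.eval xQ = 0 then none
        else
          let yQ := -U.eval xQ / V.eval xQ
          let dP := lastIndex Z
          if dP ∣ d then
            (affinePoint W xQ yQ).map fun Q => (-((d / dP : ℕ) : ℤ)) • Q
          else none
      else none
    else none

/-- The algorithm, with input the curve `W`, the polynomial `T` and the polynomials `xP`, `yP` such
that the point is `(xP(θ), yP(θ))`, using the subroutine `kernel` for echelon kernel matrices. The
value `none` means failure. -/
noncomputable def ellTraceSep (kernel : KernelRoutine K) (W : WeierstrassCurve.Affine K)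
    [W.IsElliptic] (T : K[X]) [Fact (Irreducible T)] (xP yP : K[X]) : Option (W⁄K).Point :=
  let d := T.natDegree
  if xP.natDegree = 0 then
    if yP.natDegree = 0 then
      (affinePoint W (xP.coeff 0) (yP.coeff 0)).map fun P => d • P
    else some 0
  else
    (leftmostColumn (kernel _ _ (valueMatrix T xP yP))).bind fun Z =>
      finish W Z (minpoly K (AdjoinRoot.mk T xP))

end Algorithm

/-- The field of definition `K(x, y)` of a point `(x, y)` of `E(L)`. -/
abbrev fieldOfDefinition (K : Type u) [Field K] {L : Type v} [Field L] [Algebra K L] (x y : L) :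
    IntermediateField K L :=
  IntermediateField.adjoin K {x, y}

end EllTrace

/-! Functions with no pole outside `O` are `U + V y`. The degree of such a function is the
`x`-degree of its norm `-R`, namely `max (2 deg U) (2 deg V + 3)`. By separability and the
definition of `K(P)`, `P` has exactly `δ = [K(P) : K]` distinct conjugates over `K(P)`. A nonzero
`f` vanishing at them has degree at least `δ`, and in case of equality its zeros are exactly these
points, all simple, so they sum to `O` (`card_le_functionDegree`, by the Chinese remainder theorem
and the class group).

Conversely, the `δ + 1` elements `1, x, y, x², xy, …` of `K(P)` are linearly dependent, which gives
a nonzero `f` of degree at most `δ + 1` (`exists_natDegree_polyR_le`). The minimal degree is thus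
`δ` or `δ + 1`. In the second case there is one residual zero; it is rational over `K`, and adding
it to the conjugates gives `O`, so it is minus the trace (`IsMinimalPair.exists_trace`). The
monomials have distinct pole orders, increasing with the column index, so the kernel column with the
most trailing zeros is the minimal function, unique up to scalars
(`exists_eq_C_mul_of_natDegree_le`).

If `V ≠ 0`, minimality gives `V(x) ≠ 0`, so `y ∈ K(x)` and the minimal polynomial of `x` has degree
`δ`; dividing it out of `R` leaves a constant or the linear factor of the residual zero. If `V = 0`,
divisibility excludes degree `δ + 1`. Finally each embedding of `K(P)` extends to `L` in `d / δ`
ways (`sum_map_eq_nsmul`). -/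

namespace EllTrace

universe u v w

/-! ### Degrees and zeros of functions in the coordinate ring. -/

section CoordinateRing

open WeierstrassCurve.Affine

variable {F : Type u} [Field F] (W : WeierstrassCurve.Affine F)

lemma ofUV_eq_smul_basis (U V : F[X]) :
    ofUV W U V = U • (1 : W.CoordinateRing) + V • CoordinateRing.mk W X := by
  simp [ofUV, CoordinateRing.smul]

lemma exists_ofUV_eq (f : W.CoordinateRing) : ∃ U V : F[X], f = ofUV W U V := by
  obtain ⟨U, V, h⟩ := CoordinateRing.exists_smul_basis_eq f
  exact ⟨U, V, by rw [ofUV_eq_smul_basis, h]⟩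

lemma ofUV_eq_zero_iff (U V : F[X]) : ofUV W U V = 0 ↔ U = 0 ∧ V = 0 := by
  refine ⟨fun h => CoordinateRing.smul_basis_eq_zero (by rwa [ofUV_eq_smul_basis] at h), ?_⟩
  rintro ⟨rfl, rfl⟩
  simp [ofUV]

lemma norm_ofUV (U V : F[X]) : Algebra.norm F[X] (ofUV W U V) = -polyR W U V := by
  rw [ofUV_eq_smul_basis, CoordinateRing.norm_smul_basis, polyR]
  ring

/-- For nonzero `U` and `V` the two degrees have opposite parity, so leading terms cannot cancel. -/
lemma degree_polyR (U V : F[X]) :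
    (polyR W U V).degree = max (2 • U.degree) (2 • V.degree + 3) := by
  rw [← CoordinateRing.degree_norm_smul_basis (W' := W), ← ofUV_eq_smul_basis, norm_ofUV,
    degree_neg]

lemma functionDegree_ofUV (U V : F[X]) :
    functionDegree W (ofUV W U V) = (polyR W U V).natDegree := by
  rw [functionDegree, norm_ofUV, natDegree_neg]

lemma compNeg_ofUV (U V : F[X]) : compNeg W (ofUV W U V) =
    CoordinateRing.mk W (C U + C V * W.negPolynomial) := by
  rw [ofUV_eq_smul_basis, map_add, map_smul, map_smul, map_one]
  have : compNeg W (CoordinateRing.mk W X) = CoordinateRing.mk W W.negPolynomial := by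
    simp only [compNeg]
    exact AdjoinRoot.liftAlgHom_root ..
  rw [this, CoordinateRing.smul, CoordinateRing.smul]
  simp

lemma algebraMap_polyR (U V : F[X]) : algebraMap F[X] W.CoordinateRing (polyR W U V) =
    -(ofUV W U V * compNeg W (ofUV W U V)) := by
  have h := CoordinateRing.coe_norm_smul_basis (W' := W) U V
  rw [← ofUV_eq_smul_basis, norm_ofUV] at h
  rw [compNeg_ofUV, ofUV, ← map_mul]
  have h2 : algebraMap F[X] W.CoordinateRing (-polyR W U V) =
    CoordinateRing.mk W ((C U + C V * X) *
      (C U + C V * (-(X : F[X][X]) - C (C W.a₁ * X + C W.a₃)))) := h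
  rw [map_neg] at h2
  rw [eq_neg_iff_add_eq_zero, ← neg_eq_iff_add_eq_zero, h2, negPolynomial]

lemma polyR_mul (l U V : F[X]) : polyR W (l * U) (l * V) = l ^ 2 * polyR W U V := by
  simp only [polyR]
  ring

lemma ofUV_C_mul (c : F) (U V : F[X]) : ofUV W (C c * U) (C c * V) = c • ofUV W U V := by
  rw [ofUV_eq_smul_basis, ofUV_eq_smul_basis, smul_add, C_mul', C_mul', smul_assoc, smul_assoc]

variable {W}

lemma polyR_ne_zero {U V : F[X]} (h : ofUV W U V ≠ 0) : polyR W U V ≠ 0 := by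
  intro h0
  have hd := degree_polyR W U V
  rw [h0, degree_zero, eq_comm, max_eq_bot, WithBot.add_eq_bot, two_nsmul, two_nsmul, ← degree_mul,
    ← degree_mul] at hd
  refine h ((ofUV_eq_zero_iff W U V).2 ⟨?_, ?_⟩)
  · simpa using hd.1
  · have := hd.2.resolve_right (by decide)
    simpa using this

lemma ofUV_mem_XYIdeal {U V : F[X]} {x y : F} (h : U.eval x + V.eval x * y = 0) :
    ofUV W U V ∈ CoordinateRing.XYIdeal W x (C y) := by
  obtain ⟨U', hU⟩ := X_sub_C_dvd_sub_C_eval (a := x) (p := U)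
  obtain ⟨V', hV⟩ := X_sub_C_dvd_sub_C_eval (a := x) (p := V)
  have hU' : U = (X - C x) * U' - C (V.eval x) * C y := by
    rw [← hU, ← C_mul, eq_neg_of_add_eq_zero_right h]
    simp
  have hV' : V = (X - C x) * V' + C (V.eval x) := by rw [← hV]; ring
  have key : (C U + C V * X : F[X][X]) =
      (C U' + C V' * X) * C (X - C x) + C (C (V.eval x)) * (X - C (C y)) := by
    generalize eval x V = v at hU' hV' ⊢
    conv_lhs => rw [hU', hV']
    simp only [C_add, C_mul, C_sub]
    ring
  rw [ofUV, key, map_add, map_mul, map_mul]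
  exact Ideal.add_mem _ (Ideal.mul_mem_left _ _ (Ideal.subset_span (Set.mem_insert _ _)))
    (Ideal.mul_mem_left _ _ (Ideal.subset_span (Set.mem_insert_of_mem _ rfl)))

/-- A difference of generators of the two ideals is a nonzero constant. -/
lemma isCoprime_XYIdeal {x y x' y' : F} (h : (x, y) ≠ (x', y')) :
    IsCoprime (CoordinateRing.XYIdeal W x (C y)) (CoordinateRing.XYIdeal W x' (C y')) := by
  rw [Ideal.isCoprime_iff_sup_eq]
  set J := CoordinateRing.XYIdeal W x (C y) ⊔ CoordinateRing.XYIdeal W x' (C y')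
  have key : ∀ c : F, c ≠ 0 → CoordinateRing.mk W (C (C c)) ∈ J → J = ⊤ := by
    intro c hc hm
    refine Ideal.eq_top_of_isUnit_mem _ hm ?_
    exact (((isUnit_iff_ne_zero.2 hc).map C).map C).map (CoordinateRing.mk W)
  have hX : CoordinateRing.XClass W x ∈ J :=
    Ideal.mem_sup_left (Ideal.subset_span (by simp))
  have hY : CoordinateRing.YClass W (C y) ∈ J :=
    Ideal.mem_sup_left (Ideal.subset_span (by simp))
  have hX' : CoordinateRing.XClass W x' ∈ J :=
    Ideal.mem_sup_right (Ideal.subset_span (by simp))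
  have hY' : CoordinateRing.YClass W (C y') ∈ J :=
    Ideal.mem_sup_right (Ideal.subset_span (by simp))
  by_cases hx : x = x'
  · refine key (y - y') (sub_ne_zero.2 fun hy => h (by rw [hx, hy])) ?_
    have := J.sub_mem hY' hY
    rw [CoordinateRing.YClass, CoordinateRing.YClass, ← map_sub] at this
    convert this using 2
    simp
  · refine key (x - x') (sub_ne_zero.2 hx) ?_
    have := J.sub_mem hX' hX
    rw [CoordinateRing.XClass, CoordinateRing.XClass, ← map_sub] at this
    convert this using 2
    simp

lemma finite_quotient_span_singleton {f : W.CoordinateRing} (hf : f ≠ 0) :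
    Module.Finite F (W.CoordinateRing ⧸ Ideal.span {f}) :=
  Module.Finite.equiv (Ideal.quotientEquivDirectSum F (CoordinateRing.basis W)
    (mt Ideal.span_singleton_eq_bot.1 hf)).symm

/-- The quotient by `f` has dimension `functionDegree W f`; by the Chinese remainder theorem it
surjects onto a product of copies of `F`, one per point. If the dimensions agree, `(f)` is the
product of the point ideals, so their ideal classes multiply to `1`, and `Point.toClass` is
injective. -/
lemma card_le_functionDegree {ι : Type v} [Fintype ι] {x y : ι → F}
    (h : ∀ i, W.Nonsingular (x i) (y i)) (hinj : Function.Injective fun i => (x i, y i))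
    {f : W.CoordinateRing} (hf : f ≠ 0)
    (hfI : ∀ i, f ∈ CoordinateRing.XYIdeal W (x i) (C (y i))) :
    Fintype.card ι ≤ functionDegree W f ∧
      (Fintype.card ι = functionDegree W f → ∑ i, Point.some _ _ (h i) = 0) := by
  set I : ι → Ideal W.CoordinateRing := fun i => CoordinateRing.XYIdeal W (x i) (C (y i)) with hI
  have hcop : Pairwise (Function.onFun IsCoprime I) := fun i j hij =>
    isCoprime_XYIdeal fun h => hij (hinj h)
  have hprod : ∏ i, I i = ⨅ i, I i := by
    simpa using Ideal.prod_eq_iInf_of_pairwise_isCoprime (s := Finset.univ) (J := I)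
      (fun i _ j _ hij => hcop hij)
  have hfin := finite_quotient_span_singleton hf
  let e (i : ι) : (W.CoordinateRing ⧸ I i) ≃ₐ[F] F :=
    CoordinateRing.quotientXYIdealEquiv (W' := W) (x := x i) (y := C (y i)) (h i).1
  have hfinI (i : ι) : Module.Finite F (W.CoordinateRing ⧸ I i) :=
    Module.Finite.equiv (e i).symm.toLinearEquiv
  have hdim : Module.finrank F (∀ i, W.CoordinateRing ⧸ I i) = Fintype.card ι := by
    rw [Module.finrank_pi_fintype]
    simp [fun i => (e i).toLinearEquiv.finrank_eq]
  have hdeg : Module.finrank F (W.CoordinateRing ⧸ Ideal.span {f}) = functionDegree W f :=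
    finrank_quotient_span_eq_natDegree_norm (CoordinateRing.basis W) hf
  have hle (i : ι) : Ideal.span {f} ≤ I i := (Ideal.span_singleton_le_iff_mem _).2 (hfI i)
  let φ : (W.CoordinateRing ⧸ Ideal.span {f}) →ₗ[F] (∀ i, W.CoordinateRing ⧸ I i) :=
    LinearMap.pi fun i => (Ideal.Quotient.factorₐ F (hle i)).toLinearMap
  have hφ (g : W.CoordinateRing) (i : ι) :
      φ (Ideal.Quotient.mk _ g) i = Ideal.Quotient.mk (I i) g := rfl
  have hsurj : Function.Surjective φ := by
    intro z
    obtain ⟨g, hg⟩ := Ideal.pi_quotient_surjective hcop z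
    exact ⟨Ideal.Quotient.mk _ g, funext fun i => by rw [hφ, ← hg i]⟩
  refine ⟨?_, fun heq => ?_⟩
  · rw [← hdim, ← hdeg]
    exact LinearMap.finrank_le_finrank_of_surjective hsurj
  · have hinjφ : Function.Injective φ :=
      (LinearMap.injective_iff_surjective_of_finrank_eq_finrank
        (by rw [hdeg, hdim, heq])).2 hsurj
    have hspan : ∏ i, I i = Ideal.span {f} := by
      rw [hprod]
      refine le_antisymm (fun g hg => ?_) (le_iInf hle)
      rw [← Ideal.Quotient.eq_zero_iff_mem]
      refine hinjφ (funext fun i => ?_)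
      rw [hφ, map_zero, Pi.zero_apply, Ideal.Quotient.eq_zero_iff_mem]
      exact (Submodule.mem_iInf _).1 hg i
    apply Point.toClass_injective
    rw [map_sum, map_zero]
    have hcl : ClassGroup.mk W.FunctionField
        (∏ i, CoordinateRing.XYIdeal' (W := W) (h i)) = 1 := by
      refine (ClassGroup.mk_eq_one_of_coe_ideal (I' := ∏ i, I i) ?_).2 ⟨f, hf, hspan⟩
      rw [Units.coe_prod, ← FractionalIdeal.coeIdealHom_apply, map_prod]
      exact Finset.prod_congr rfl fun i _ => CoordinateRing.XYIdeal'_eq (h i)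
    rw [map_prod] at hcl
    exact hcl

end CoordinateRing

/-! ### Echelon bases of kernels and their leftmost column. -/

section EchelonForm

variable {K : Type u} [Field K]

lemma exists_last_ne_zero {n : ℕ} {v : Fin n → K} (hv : v ≠ 0) :
    ∃ i, v i ≠ 0 ∧ ∀ k, i < k → v k = 0 := by
  obtain ⟨j, hj⟩ := Function.ne_iff.1 hv
  obtain ⟨i, hi⟩ := (Finset.univ.filter fun i => v i ≠ 0).exists_maximal ⟨j, by simpa using hj⟩
  refine ⟨i, by simpa using hi.1, fun k hk => ?_⟩
  by_contra h
  exact absurd (hi.2 (by simpa using h) hk.le) (not_le.2 hk)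

lemma trailingZeros_eq {n : ℕ} {v : Fin n → K} {i : Fin n} (hi : v i ≠ 0)
    (h : ∀ k, i < k → v k = 0) : trailingZeros v = n - 1 - i := by
  rw [trailingZeros, ← Fin.card_Ioi]
  congr 1
  ext j
  simp only [Finset.mem_filter, Finset.mem_univ, true_and, Finset.mem_Ioi]
  exact ⟨fun hj => not_le.1 fun hji => hi (hj i hji), fun hj k hk => h k (hj.trans_le hk)⟩

lemma le_trailingZeros {n m : ℕ} {v : Fin n → K} (h : ∀ k : Fin n, m ≤ k → v k = 0) :
    n - m ≤ trailingZeros v := by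
  by_cases hv : v = 0
  · subst hv
    simp [trailingZeros]
  · obtain ⟨i, hi, hk⟩ := exists_last_ne_zero hv
    rw [trailingZeros_eq hi hk]
    have : (i : ℕ) < m := by
      by_contra hm
      exact hi (h i (not_lt.1 hm))
    omega

/-- Every subspace of `Kⁿ` has a basis in echelon form. -/
lemma exists_echelon_basis {n : ℕ} (m : ℕ) : ∀ (N : Submodule K (Fin n → K)),
    (∀ v ∈ N, ∀ k : Fin n, m ≤ k → v k = 0) →
    ∃ (r : ℕ) (c : Fin r → Fin n → K), LinearIndependent K c ∧
      Submodule.span K (Set.range c) = N ∧ StrictAnti fun j => trailingZeros (c j) := by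
  induction m with
  | zero =>
    intro N hN
    refine ⟨0, Fin.elim0, linearIndependent_empty_type, ?_, fun i => i.elim0⟩
    rw [Set.range_eq_empty, Submodule.span_empty, eq_comm, Submodule.eq_bot_iff]
    exact fun v hv => funext fun k => hN v hv k (Nat.zero_le _)
  | succ m ih =>
    intro N hN
    by_cases hm : ∀ v ∈ N, ∀ k : Fin n, m ≤ k → v k = 0
    · exact ih N hm
    · push Not at hm
      obtain ⟨v, hvN, k, hmk, hvk⟩ := hm
      have hkm : (k : ℕ) = m := by
        refine le_antisymm ?_ hmk
        by_contra h
        exact hvk (hN v hvN k (by omega))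
      -- The vectors of `N` whose coordinate `k = m` also vanishes; together with `v` they span `N`.
      let N' := N ⊓ LinearMap.ker (LinearMap.proj (R := K) (φ := fun _ : Fin n => K) k)
      obtain ⟨r, c, hli, hspan, hanti⟩ := ih N' (by
        intro w hw i hi
        rcases hi.eq_or_lt with h | h
        · rw [show i = k from Fin.ext (h.symm.trans hkm.symm)]
          exact hw.2
        · exact hN w hw.1 i h)
      have hcN' (j) : c j ∈ N' := hspan ▸ Submodule.subset_span ⟨j, rfl⟩
      have hzero (w) (hw : w ∈ N') (i : Fin n) (hi : m ≤ i) : w i = 0 := by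
        rcases hi.eq_or_lt with h | h
        · rw [show i = k from Fin.ext (h.symm.trans hkm.symm)]
          exact hw.2
        · exact hN w hw.1 i h
      have hvlast : trailingZeros v = n - 1 - k :=
        trailingZeros_eq hvk fun i hi => hN v hvN i (by
          have : (k : ℕ) < i := hi
          omega)
      -- The vector `v` goes last: its entry at `m` is nonzero, so it has fewer trailing zeros than
      -- every `c j`.
      refine ⟨r + 1, Fin.snoc c v, linearIndependent_finSnoc.2 ⟨hli, ?_⟩, ?_, ?_⟩
      · rw [hspan]
        exact fun h => hvk h.2
      · rw [Fin.range_snoc, Submodule.span_insert, hspan]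
        apply le_antisymm
        · exact sup_le ((Submodule.span_singleton_le_iff_mem _ _).2 hvN) inf_le_left
        · intro w hw
          refine Submodule.mem_sup.2 ⟨(w k / v k) • v, Submodule.smul_mem _ _
            (Submodule.mem_span_singleton_self v), w - (w k / v k) • v, ⟨?_, ?_⟩, by simp⟩
          · exact N.sub_mem hw (N.smul_mem _ hvN)
          · simp [hvk]
      · intro i j hij
        induction j using Fin.lastCases with
        | last =>
          induction i using Fin.lastCases with
          | last => exact absurd hij (lt_irrefl _)
          | cast i =>
            simp only [Fin.snoc_castSucc, Fin.snoc_last]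
            rw [hvlast]
            have := le_trailingZeros (hzero _ (hcN' i))
            have := k.2
            omega
        | cast j =>
          induction i using Fin.lastCases with
          | last => exact absurd hij (not_lt.2 (Fin.le_last _))
          | cast i =>
            simp only [Fin.snoc_castSucc]
            exact hanti (Fin.castSucc_lt_castSucc_iff.1 hij)

lemma exists_isCorrect : ∃ kernel : KernelRoutine K, kernel.IsCorrect := by
  have h (m n : ℕ) (M : Matrix (Fin m) (Fin n) K) :
      ∃ Z : Σ r : ℕ, Matrix (Fin n) (Fin r) K, IsEchelonKernelMatrix M Z.2 := by
    obtain ⟨r, c, hli, hspan, hanti⟩ := exists_echelon_basis n (LinearMap.ker M.mulVecLin)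
      fun v _ k hk => absurd k.2 (not_lt.2 hk)
    exact ⟨⟨r, (Matrix.of c).transpose⟩, hli, hspan, hanti⟩
  choose kernel hkernel using h
  exact ⟨kernel, hkernel⟩

/-- The last nonzero positions `b j` increase strictly with `j`. In a nontrivial combination, the
last column that occurs is the only one contributing at its own `b j`, so the combination cannot
vanish from `b 0` onwards. -/
lemma IsEchelonKernelMatrix.exists_last {m n r : ℕ} {M : Matrix (Fin m) (Fin n) K}
    {Z : Matrix (Fin n) (Fin r) K} (hZ : IsEchelonKernelMatrix M Z) (hr : 0 < r) :
    ∃ b, Z.col ⟨0, hr⟩ b ≠ 0 ∧ (∀ k, b < k → Z.col ⟨0, hr⟩ k = 0) ∧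
      ∀ w ∈ LinearMap.ker M.mulVecLin, (∀ k, b ≤ k → w k = 0) → w = 0 := by
  choose b hb hlast using fun j => exists_last_ne_zero (hZ.linearIndependent.ne_zero j)
  have hmono : StrictMono b := by
    intro i j hij
    have h := hZ.strictAnti hij
    simp only [trailingZeros_eq (hb _) (hlast _)] at h
    exact Fin.lt_def.2 (by omega)
  refine ⟨b ⟨0, hr⟩, hb _, hlast _, fun w hw h0 => ?_⟩
  rw [← hZ.span_eq_ker] at hw
  obtain ⟨c, rfl⟩ := (Submodule.mem_span_range_iff_exists_fun K).1 hw
  by_contra hne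
  have hc : c ≠ 0 := by
    rintro rfl
    simp at hne
  obtain ⟨j, hj, hjlast⟩ := exists_last_ne_zero hc
  have h1 := h0 (b j) (hmono.monotone (Fin.le_def.2 (Nat.zero_le _)))
  rw [Finset.sum_apply, Finset.sum_eq_single j] at h1
  · exact mul_ne_zero hj (hb j) h1
  · intro i _ hij
    rcases lt_or_gt_of_ne hij with h | h
    · rw [Pi.smul_apply, hlast i (b j) (hmono h), smul_zero]
    · simp [hjlast i h]
  · simp

lemma leftmostColumn_eq_some {m n : ℕ} {M : Matrix (Fin m) (Fin n) K} (hmn : m < n)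
    {Z : Σ r : ℕ, Matrix (Fin n) (Fin r) K} (hZ : IsEchelonKernelMatrix M Z.2) :
    ∃ z, leftmostColumn Z = some z ∧ M.mulVec z = 0 ∧
      ∃ b, z b ≠ 0 ∧ (∀ k, b < k → z k = 0) ∧
        ∀ w, M.mulVec w = 0 → (∀ k, b ≤ k → w k = 0) → w = 0 := by
  have hr : 0 < Z.1 := by
    by_contra h
    have : IsEmpty (Fin Z.1) := by
      rw [Nat.eq_zero_of_not_pos h]
      infer_instance
    have hker := hZ.span_eq_ker
    rw [Set.range_eq_empty, Submodule.span_empty] at hker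
    exact LinearMap.ker_ne_bot_of_finrank_lt (f := M.mulVecLin) (by simpa using hmn) hker.symm
  refine ⟨Z.2.col ⟨0, hr⟩, dif_pos hr, ?_, ?_⟩
  · have : Z.2.col ⟨0, hr⟩ ∈ LinearMap.ker M.mulVecLin :=
      hZ.span_eq_ker ▸ Submodule.subset_span ⟨_, rfl⟩
    simpa using this
  · obtain ⟨b, hb, hlast, h⟩ := hZ.exists_last hr
    exact ⟨b, hb, hlast, fun w hw => h w (by simpa using hw)⟩

end EchelonForm

/-! ### Dictionary between columns, pairs `(U, V)` and pole orders. -/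

section Values

lemma values_odd {A : Type v} [CommRing A] (x y : A) (m : ℕ) :
    values x y (2 * m + 1) = x ^ (m + 1) := by
  induction m with
  | zero => simp [values]
  | succ m ih => rw [show 2 * (m + 1) + 1 = 2 * m + 3 by ring, values, ih]; ring

lemma values_even {A : Type v} [CommRing A] (x y : A) (m : ℕ) :
    values x y (2 * m + 2) = x ^ m * y := by
  induction m with
  | zero => simp [values]
  | succ m ih => rw [show 2 * (m + 1) + 2 = 2 * m + 1 + 3 by ring, values, ih]; ring

/-- Coefficients are indexed from `1` and values from `0`. Each induction step adds one term,
alternately to the `U`-sum and to the `V`-sum. -/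
lemma sum_mul_values {A : Type v} [CommRing A] (x y : A) (a : ℕ → A) (n : ℕ) :
    ∑ k ∈ Finset.range (n + 1), a (k + 1) * values x y k =
      a 1 + ∑ j ∈ Finset.Icc 1 ((n + 1) / 2), a (2 * j) * x ^ j +
        (∑ j ∈ Finset.range (n / 2), a (2 * j + 3) * x ^ j) * y := by
  induction n with
  | zero => simp [values]
  | succ n ih =>
    rw [Finset.sum_range_succ, ih]
    obtain ⟨m, rfl | rfl⟩ := Nat.even_or_odd' n
    · rw [values_odd, show (2 * m + 1 + 1) / 2 = m + 1 by omega,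
        show (2 * m + 1) / 2 = m by omega, show 2 * m / 2 = m by omega,
        Finset.sum_Icc_succ_top (by omega), show 2 * m + 1 + 1 = 2 * (m + 1) by ring]
      ring
    · rw [values_even, show (2 * m + 1 + 1 + 1) / 2 = m + 1 by omega,
        show (2 * m + 1 + 1) / 2 = m + 1 by omega, show (2 * m + 1) / 2 = m by omega,
        Finset.sum_range_succ, show 2 * m + 1 + 1 + 1 = 2 * m + 3 by ring]
      ring

variable {K : Type u} [Field K] {d : ℕ}

lemma entry_succ (Z : Fin (d + 1) → K) (k : Fin (d + 1)) : entry Z (k + 1) = Z k := by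
  have := k.2
  rw [entry, dif_pos (by omega)]
  rfl

lemma entry_eq_zero_of_lt (Z : Fin (d + 1) → K) {k : ℕ} (hk : d + 1 < k) : entry Z k = 0 := by
  rw [entry, dif_neg (by omega)]

lemma entry_smul (c : K) (Z : Fin (d + 1) → K) (k : ℕ) : entry (c • Z) k = c * entry Z k := by
  simp only [entry]
  split_ifs <;> simp

lemma coeff_polyU_zero (Z : Fin (d + 1) → K) : (polyU Z).coeff 0 = entry Z 1 := by
  simp [polyU, coeff_zero_eq_eval_zero, eval_finsetSum]
  refine Finset.sum_eq_zero fun j hj => ?_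
  simp [(show j ≠ 0 by have := (Finset.mem_Icc.1 hj).1; omega)]

lemma coeff_polyU (Z : Fin (d + 1) → K) {j : ℕ} (hj : 1 ≤ j) :
    (polyU Z).coeff j = entry Z (2 * j) := by
  rw [polyU, coeff_add, coeff_C, if_neg (by omega), zero_add, finsetSum_coeff]
  simp only [coeff_C_mul, coeff_X_pow, mul_ite, mul_one, mul_zero, Finset.sum_ite_eq,
    Finset.mem_Icc]
  split_ifs with h
  · rfl
  · exact (entry_eq_zero_of_lt Z (by omega)).symm

lemma coeff_polyV (Z : Fin (d + 1) → K) (j : ℕ) :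
    (polyV Z).coeff j = entry Z (2 * j + 3) := by
  rw [polyV, finsetSum_coeff]
  simp only [coeff_C_mul, coeff_X_pow, mul_ite, mul_one, mul_zero, Finset.sum_ite_eq,
    Finset.mem_range]
  split_ifs with h
  · rfl
  · exact (entry_eq_zero_of_lt Z (by omega)).symm

lemma polyU_smul (c : K) (Z : Fin (d + 1) → K) : polyU (c • Z) = C c * polyU Z := by
  ext j
  rw [coeff_C_mul]
  rcases Nat.eq_zero_or_pos j with rfl | hj
  · simp only [coeff_polyU_zero, entry_smul]
  · simp only [coeff_polyU _ hj, entry_smul]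

lemma polyV_smul (c : K) (Z : Fin (d + 1) → K) : polyV (c • Z) = C c * polyV Z := by
  ext j
  rw [coeff_C_mul]
  simp only [coeff_polyV, entry_smul]

lemma entry_eq_zero_of_polyU_polyV {Z : Fin (d + 1) → K} (hU : polyU Z = 0) (hV : polyV Z = 0) :
    Z = 0 := by
  ext k
  rw [← entry_succ Z k]
  obtain ⟨m, h | h⟩ := Nat.even_or_odd' (k : ℕ)
  · rcases Nat.eq_zero_or_pos m with rfl | hm
    · rw [h, ← coeff_polyU_zero, hU]
      rfl
    · obtain ⟨m, rfl⟩ := Nat.exists_eq_succ_of_ne_zero hm.ne'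
      rw [h, show 2 * m.succ + 1 = 2 * m + 3 by omega, ← coeff_polyV, hV]
      rfl
  · rw [h, show 2 * m + 1 + 1 = 2 * (m + 1) by ring, ← coeff_polyU _ (by omega), hU]
    rfl

lemma exists_polyU_polyV_eq {U V : K[X]} (hU : ∀ j, d + 1 < 2 * j → U.coeff j = 0)
    (hV : ∀ j, d + 1 < 2 * j + 3 → V.coeff j = 0) :
    ∃ Z : Fin (d + 1) → K, polyU Z = U ∧ polyV Z = V := by
  -- Position `1` holds the constant term of `U`, even positions its other coefficients, odd
  -- positions from `3` on those of `V`.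
  let a : ℕ → K := fun k => if k = 1 then U.coeff 0 else
    if k % 2 = 0 then U.coeff (k / 2) else V.coeff ((k - 3) / 2)
  have ha (k : ℕ) (hk : 1 ≤ k) (hk' : k ≤ d + 1) :
      entry (fun i : Fin (d + 1) => a (i + 1)) k = a k := by
    rw [entry, dif_pos ⟨hk, hk'⟩]
    simp only
    rw [Nat.sub_add_cancel hk]
  refine ⟨fun i => a (i + 1), ?_, ?_⟩
  · ext j
    rcases Nat.eq_zero_or_pos j with rfl | hj
    · rw [coeff_polyU_zero, ha 1 le_rfl (by omega)]
      simp [a]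
    · rw [coeff_polyU _ hj]
      by_cases h : d + 1 < 2 * j
      · rw [entry_eq_zero_of_lt _ h, hU j h]
      · rw [ha _ (by omega) (by omega)]
        simp [a]
  · ext j
    rw [coeff_polyV]
    by_cases h : d + 1 < 2 * j + 3
    · rw [entry_eq_zero_of_lt _ h, hV j h]
    · rw [ha _ (by omega) (by omega)]
      simp only [a]
      rw [if_neg (by omega), if_neg (by omega)]
      congr 1
      omega

lemma sum_smul_values {A : Type v} [CommRing A] [Algebra K A] (x y : A) (Z : Fin (d + 1) → K) :
    ∑ k : Fin (d + 1), Z k • values x y k =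
      aeval x (polyU Z) + aeval x (polyV Z) * y := by
  have h := sum_mul_values x y (fun k => algebraMap K A (entry Z k)) d
  rw [Finset.sum_range] at h
  simp only [entry_succ] at h
  simp only [Algebra.smul_def, h, polyU, polyV, map_add, map_sum, map_mul, aeval_C, map_pow, aeval_X]

lemma valueMatrix_mulVec_eq_zero_iff (T : K[X]) [Fact (Irreducible T)] (xP yP : K[X])
    (Z : Fin (T.natDegree + 1) → K) : (valueMatrix T xP yP).mulVec Z = 0 ↔
      aeval (AdjoinRoot.mk T xP) (polyU Z) +
        aeval (AdjoinRoot.mk T xP) (polyV Z) * AdjoinRoot.mk T yP = 0 := by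
  rw [← sum_smul_values, ← (AdjoinRoot.powerBasisAux
    (Fact.out (p := Irreducible T)).ne_zero).repr.map_eq_zero_iff, Finsupp.ext_iff, funext_iff]
  refine forall_congr' fun i => ?_
  simp [Matrix.mulVec, dotProduct, valueMatrix, mul_comm]

variable (W : WeierstrassCurve.Affine K)

lemma natDegree_polyR_le_iff {U V : K[X]} {N : ℕ} : (polyR W U V).natDegree ≤ N ↔
    (∀ j, N < 2 * j → U.coeff j = 0) ∧ ∀ j, N < 2 * j + 3 → V.coeff j = 0 := by
  rw [natDegree_le_iff_degree_le, degree_polyR, max_le_iff]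
  refine and_congr ?_ ?_
  · by_cases hU : U = 0
    · simp [hU]
    rw [degree_eq_natDegree hU, two_nsmul]
    norm_cast
    refine ⟨fun h j hj => coeff_eq_zero_of_natDegree_lt (by omega), fun h => ?_⟩
    by_contra hN
    exact hU (leadingCoeff_eq_zero.1 (h _ (by omega)))
  · by_cases hV : V = 0
    · simp [hV]
    rw [degree_eq_natDegree hV, two_nsmul]
    norm_cast
    refine ⟨fun h j hj => coeff_eq_zero_of_natDegree_lt (by omega), fun h => ?_⟩
    by_contra hN
    exact hV (leadingCoeff_eq_zero.1 (h _ (by omega)))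

/-- For `k ≥ 1`, entry `k + 1` is the coefficient of a monomial of pole order `k + 1`, while entry
`1` belongs to the constant `1`, of pole order `0`. Pole order `1` does not occur, whence the
condition `1 ≤ k`. -/
lemma natDegree_polyR_polyU_polyV_le_iff (Z : Fin (d + 1) → K) {N : ℕ} :
    (polyR W (polyU Z) (polyV Z)).natDegree ≤ N ↔
      ∀ k, 1 ≤ k → N ≤ k → entry Z (k + 1) = 0 := by
  rw [natDegree_polyR_le_iff]
  constructor
  · rintro ⟨hU, hV⟩ k hk hN
    obtain ⟨m, h | h⟩ := Nat.even_or_odd' k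
    · rw [show k + 1 = 2 * (m - 1) + 3 by omega, ← coeff_polyV]
      exact hV _ (by omega)
    · rw [show k + 1 = 2 * (m + 1) by omega, ← coeff_polyU _ (by omega)]
      exact hU _ (by omega)
  · intro h
    refine ⟨fun j hj => ?_, fun j hj => ?_⟩
    · rw [coeff_polyU _ (by omega), show 2 * j = 2 * j - 1 + 1 by omega]
      exact h _ (by omega) (by omega)
    · rw [coeff_polyV]
      exact h (2 * j + 2) (by omega) (by omega)

lemma natDegree_polyR_polyU_polyV_le (Z : Fin (d + 1) → K) :
    (polyR W (polyU Z) (polyV Z)).natDegree ≤ d + 1 :=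
  (natDegree_polyR_polyU_polyV_le_iff W Z).2 fun _ _ hk => entry_eq_zero_of_lt Z (by omega)

lemma lastIndex_eq {Z : Fin (d + 1) → K} {N : ℕ} (hN : 1 ≤ N)
    (h : (polyR W (polyU Z) (polyV Z)).natDegree = N + 1) : lastIndex Z = N := by
  have h1 := (natDegree_polyR_polyU_polyV_le_iff W Z).1 h.le
  have h2 := mt (natDegree_polyR_polyU_polyV_le_iff W Z (N := N)).2 (by omega)
  push Not at h2
  obtain ⟨k, hk1, hk, hne⟩ := h2
  have hkN : k = N := by
    by_contra hkN
    exact hne (h1 k hk1 (by omega))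
  subst hkN
  have hkd : k ≤ d := by
    by_contra hkd
    exact hne (entry_eq_zero_of_lt Z (by omega))
  exact Nat.findGreatest_eq_iff.2 ⟨hkd, fun _ => hne, fun n hn _ => by
    rw [not_not]
    exact h1 n (by omega) hn⟩

/-- The echelon form makes the function of the leftmost column one of minimal degree. -/
lemma exists_eq_C_mul_of_natDegree_le (T : K[X]) [Fact (Irreducible T)] (xP yP : K[X])
    {z : Fin (T.natDegree + 1) → K} (hz : (valueMatrix T xP yP).mulVec z = 0)
    {b : Fin (T.natDegree + 1)} (hb : z b ≠ 0) (hlast : ∀ k, b < k → z k = 0)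
    (hmin : ∀ w, (valueMatrix T xP yP).mulVec w = 0 → (∀ k, b ≤ k → w k = 0) → w = 0)
    {U V : K[X]} (hUV : aeval (AdjoinRoot.mk T xP) U +
      aeval (AdjoinRoot.mk T xP) V * AdjoinRoot.mk T yP = 0)
    (hdeg : (polyR W U V).natDegree ≤ (polyR W (polyU z) (polyV z)).natDegree) :
    ∃ c : K, U = C c * polyU z ∧ V = C c * polyV z := by
  obtain ⟨w, rfl, rfl⟩ : ∃ w : Fin (T.natDegree + 1) → K, polyU w = U ∧ polyV w = V := by
    have := (natDegree_polyR_le_iff W).1 (hdeg.trans (natDegree_polyR_polyU_polyV_le W z))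
    exact exists_polyU_polyV_eq this.1 this.2
  -- The case `b = 0` is that of a constant function, whose degree is `0` and not `b + 1`.
  have hzdeg : (polyR W (polyU z) (polyV z)).natDegree ≤ (if (b : ℕ) = 0 then 0 else (b : ℕ) + 1) := by
    rw [natDegree_polyR_polyU_polyV_le_iff]
    intro k hk1 hk
    by_cases hkd : T.natDegree < k
    · exact entry_eq_zero_of_lt z (by omega)
    · rw [show k = ((⟨k, by omega⟩ : Fin (T.natDegree + 1)) : ℕ) from rfl, entry_succ]
      refine hlast _ (Fin.lt_def.2 ?_)
      simp only
      split_ifs at hk <;> omega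
  have hw : ∀ k, b < k → w k = 0 := by
    intro k hk
    have hk' : (b : ℕ) < k := hk
    rw [← entry_succ w k]
    refine (natDegree_polyR_polyU_polyV_le_iff W w).1 (hdeg.trans hzdeg) k (by omega) ?_
    split_ifs <;> omega
  -- Both columns end at `b` or before; subtracting a multiple of `z` kills the entry at `b`, and
  -- the minimality of `b` makes the difference vanish.
  have h0 := hmin (w - (w b / z b) • z) (by
    rw [Matrix.mulVec_sub, Matrix.mulVec_smul, hz, (valueMatrix_mulVec_eq_zero_iff T xP yP w).2 hUV]
    simp) (by
    intro k hk
    rcases hk.eq_or_lt with rfl | hk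
    · simp [hb]
    · simp [hlast k hk, hw k hk])
  refine ⟨w b / z b, ?_⟩
  rw [← polyU_smul, ← polyV_smul, ← sub_eq_zero.1 h0]
  exact ⟨rfl, rfl⟩

end Values

/-! ### Conjugates of a point, and sums over embeddings. -/

section Conjugates

open WeierstrassCurve.Affine

variable {K : Type u} [Field K]

lemma isSeparable_adjoinRoot {T : K[X]} [Fact (Irreducible T)] (hT : T.Separable) :
    Algebra.IsSeparable K (AdjoinRoot T) := by
  rw [← separableClosure.eq_top_iff, eq_top_iff]
  intro z _
  have hroot : AdjoinRoot.root T ∈ separableClosure K (AdjoinRoot T) := by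
    rw [mem_separableClosure_iff]
    refine hT.of_dvd (minpoly.dvd _ _ ?_)
    rw [aeval_def, AdjoinRoot.algebraMap_eq, AdjoinRoot.eval₂_root]
  have hz : z ∈ Algebra.adjoin K {AdjoinRoot.root T} := by
    rw [AdjoinRoot.adjoinRoot_eq_top]
    trivial
  exact Algebra.adjoin_le (S := (separableClosure K (AdjoinRoot T)).toSubalgebra)
    (Set.singleton_subset_iff.2 hroot) hz

variable (W : WeierstrassCurve.Affine K)

lemma polyR_map {F : Type v} [Field F] [Algebra K F] (U V : K[X]) :
    polyR (W⁄F) (U.map (algebraMap K F)) (V.map (algebraMap K F)) =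
      (polyR W U V).map (algebraMap K F) := by
  simp [polyR, WeierstrassCurve.baseChange]

variable {W}

lemma card_le_natDegree_polyR {F : Type v} [Field F] [Algebra K F] {ι : Type w} [Fintype ι]
    {x y : ι → F} (h : ∀ i, (W⁄F).Nonsingular (x i) (y i))
    (hinj : Function.Injective fun i => (x i, y i)) {U V : K[X]} (hf : ofUV W U V ≠ 0)
    (h0 : ∀ i, aeval (x i) U + aeval (x i) V * y i = 0) :
    Fintype.card ι ≤ (polyR W U V).natDegree ∧
      (Fintype.card ι = (polyR W U V).natDegree → ∑ i, Point.some _ _ (h i) = 0) := by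
  have key := card_le_functionDegree h hinj
    (f := ofUV (W⁄F) (U.map (algebraMap K F)) (V.map (algebraMap K F)))
    (by
      rw [Ne, ofUV_eq_zero_iff] at hf ⊢
      simpa [Polynomial.map_eq_zero] using hf)
    (fun i => ofUV_mem_XYIdeal (by simpa [eval_map_algebraMap] using h0 i))
  rwa [functionDegree_ofUV, polyR_map, natDegree_map] at key

variable {L : Type v} [Field L] [Algebra K L]

/-- A point, regarded as a point over its field of definition. -/
lemma exists_point_fieldOfDefinition {x y : L} (h : (W⁄L).Nonsingular x y) :
    ∃ (x' y' : fieldOfDefinition K x y) (h' : (W⁄(fieldOfDefinition K x y)).Nonsingular x' y'),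
      (x' : L) = x ∧ (y' : L) = y ∧
      Point.map (W' := W) (fieldOfDefinition K x y).val (Point.some x' y' h') =
        Point.some x y h := by
  have hx : x ∈ fieldOfDefinition K x y := IntermediateField.subset_adjoin _ _ (by simp)
  have hy : y ∈ fieldOfDefinition K x y := IntermediateField.subset_adjoin _ _ (by simp)
  exact ⟨⟨x, hx⟩, ⟨y, hy⟩, (W.baseChange_nonsingular
    (f := (fieldOfDefinition K x y).val) (fieldOfDefinition K x y).val.injective ⟨x, hx⟩ ⟨y, hy⟩).1 h,
    rfl, rfl, rfl⟩

variable {Ω : Type w} [Field Ω] [Algebra K Ω]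

/-- The coordinates generate the field of definition, so the conjugates over it are pairwise
distinct points, as counting zeros requires. -/
lemma injective_conjugates {x y : L} {x' y' : fieldOfDefinition K x y}
    (hx : (x' : L) = x) (hy : (y' : L) = y) :
    Function.Injective fun j : fieldOfDefinition K x y →ₐ[K] Ω => (j x', j y') := by
  intro j₁ j₂ h
  refine IntermediateField.adjoin_algHom_ext K ?_
  rintro z (hz | hz)
  · have e : (⟨z, IntermediateField.subset_adjoin K {x, y} (Or.inl hz)⟩ :
        fieldOfDefinition K x y) = x' := Subtype.ext (Eq.trans hz hx.symm)
    exact (congrArg j₁ e).trans ((congrArg Prod.fst h).trans (congrArg j₂ e).symm)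
  · have e : (⟨z, IntermediateField.subset_adjoin K {x, y} (Or.inr hz)⟩ :
        fieldOfDefinition K x y) = y' := Subtype.ext (Eq.trans hz hy.symm)
    exact (congrArg j₁ e).trans ((congrArg Prod.snd h).trans (congrArg j₂ e).symm)

lemma aeval_conjugate {x y : L} {x' y' : fieldOfDefinition K x y}
    (hx : (x' : L) = x) (hy : (y' : L) = y) {U V : K[X]} (h0 : aeval x U + aeval x V * y = 0)
    (j : fieldOfDefinition K x y →ₐ[K] Ω) : aeval (j x') U + aeval (j x') V * j y' = 0 := by
  have hval (p : K[X]) : ((aeval x' p : fieldOfDefinition K x y) : L) = aeval x p :=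
    (aeval_algHom_apply (fieldOfDefinition K x y).val x' p).symm.trans
      (congrArg (fun t => aeval t p) hx)
  have h : aeval x' U + aeval x' V * y' = 0 := by
    apply Subtype.ext
    rw [IntermediateField.coe_add, IntermediateField.coe_mul, hval, hval, hy, h0]
    rfl
  rw [aeval_algHom_apply, aeval_algHom_apply, ← map_mul, ← map_add, h, map_zero]

variable [FiniteDimensional K L] [Algebra.IsSeparable K L]

lemma isTrace_iff (P : (W⁄L).Point) (S : (W⁄K).Point) : IsTrace W L Ω P S ↔
    Point.map (W' := W) (Algebra.ofId K Ω) S = ∑ j : L →ₐ[K] Ω, Point.map (W' := W) j P := by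
  rw [IsTrace, Algebra.IsSeparable.finInsepDegree_eq, one_smul, finsum_eq_sum_of_fintype]

variable [IsAlgClosed Ω]

lemma finrank_le_natDegree_polyR {x y : L} {x' y' : fieldOfDefinition K x y}
    (hx : (x' : L) = x) (hy : (y' : L) = y)
    (h' : (W⁄(fieldOfDefinition K x y)).Nonsingular x' y') {U V : K[X]}
    (hf : ofUV W U V ≠ 0) (h0 : aeval x U + aeval x V * y = 0) :
    Module.finrank K (fieldOfDefinition K x y) ≤ (polyR W U V).natDegree ∧
    (Module.finrank K (fieldOfDefinition K x y) = (polyR W U V).natDegree →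
      ∑ j : fieldOfDefinition K x y →ₐ[K] Ω,
        Point.map (W' := W) j (Point.some x' y' h') = 0) := by
  rw [← AlgHom.card K (fieldOfDefinition K x y) Ω]
  exact card_le_natDegree_polyR (fun j : fieldOfDefinition K x y →ₐ[K] Ω =>
    (W.baseChange_nonsingular j.injective x' y').2 h') (injective_conjugates hx hy) hf
    (aeval_conjugate hx hy h0)

/-- The rational zero `(x₀, y₀)` is not a conjugate, because `x ≠ x₀`. Adjoining it as the `none`
index gives `δ + 1` distinct zeros of a function of degree `δ + 1`. -/
lemma sum_conjugates_add_eq_zero {x y : L} {x' y' : fieldOfDefinition K x y}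
    (hx : (x' : L) = x) (hy : (y' : L) = y)
    (h' : (W⁄(fieldOfDefinition K x y)).Nonsingular x' y') {U V : K[X]}
    (hf : ofUV W U V ≠ 0) (h0 : aeval x U + aeval x V * y = 0)
    {x₀ y₀ : K} (h₀ : (W⁄K).Nonsingular x₀ y₀) (hx₀ : x ≠ algebraMap K L x₀)
    (hUV₀ : U.eval x₀ + V.eval x₀ * y₀ = 0)
    (hdeg : (polyR W U V).natDegree = Module.finrank K (fieldOfDefinition K x y) + 1) :
    Point.map (W' := W) (Algebra.ofId K Ω) (Point.some x₀ y₀ h₀) +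
      ∑ j : fieldOfDefinition K x y →ₐ[K] Ω,
        Point.map (W' := W) j (Point.some x' y' h') = 0 := by
  let a : Option (fieldOfDefinition K x y →ₐ[K] Ω) → Ω :=
    fun o => o.elim (algebraMap K Ω x₀) fun j => j x'
  let b : Option (fieldOfDefinition K x y →ₐ[K] Ω) → Ω :=
    fun o => o.elim (algebraMap K Ω y₀) fun j => j y'
  have hns : ∀ o, (W⁄Ω).Nonsingular (a o) (b o) := by
    rintro (_ | j)
    · exact (W.baseChange_nonsingular (f := Algebra.ofId K Ω) (Algebra.ofId K Ω).injective x₀ y₀).2 h₀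
    · exact (W.baseChange_nonsingular j.injective x' y').2 h'
  have hne (j : fieldOfDefinition K x y →ₐ[K] Ω) : j x' ≠ algebraMap K Ω x₀ := by
    intro h
    rw [← j.commutes] at h
    exact hx₀ (hx ▸ congrArg Subtype.val (j.injective h))
  have hinj : Function.Injective fun o => (a o, b o) := by
    rintro (_ | j₁) (_ | j₂) h
    · rfl
    · exact absurd (congrArg Prod.fst h).symm (hne j₂)
    · exact absurd (congrArg Prod.fst h) (hne j₁)
    · exact congrArg some (injective_conjugates hx hy h)
  have h0' : ∀ o, aeval (a o) U + aeval (a o) V * b o = 0 := by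
    rintro (_ | j)
    · have := congrArg (algebraMap K Ω) hUV₀
      simpa [a, b, aeval_algebraMap_apply] using this
    · exact aeval_conjugate hx hy h0 j
  have key := (card_le_natDegree_polyR hns hinj hf h0').2 (by
    rw [Fintype.card_option, AlgHom.card, hdeg])
  rw [Fintype.sum_option] at key
  exact key

/-- Embeddings of `L` are grouped by their restriction to `M`; by separability each fibre has `[L :
M]` elements. -/
lemma sum_map_eq_nsmul {M : IntermediateField K L} {P' : (W⁄M).Point} {P : (W⁄L).Point}
    (hP : Point.map (W' := W) M.val P' = P) :
    ∑ j : L →ₐ[K] Ω, Point.map (W' := W) j P =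
      (Module.finrank K L / Module.finrank K M) •
        ∑ j : M →ₐ[K] Ω, Point.map (W' := W) j P' := by
  have hcard (f : M →ₐ[K] Ω) :
      Nat.card (@AlgHom M L Ω _ _ _ _ f.toRingHom.toAlgebra) =
        Module.finrank K L / Module.finrank K M := by
    let := f.toRingHom.toAlgebra
    rw [← Module.finrank_mul_finrank K M L, Nat.mul_div_cancel_left _ Module.finrank_pos]
    exact AlgHom.natCard_of_splits M L Ω fun _ => IsAlgClosed.splits _
  have hfib : ∀ f : M →ₐ[K] Ω, Finite (@AlgHom M L Ω _ _ _ _ f.toRingHom.toAlgebra) := fun f => by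
    let := f.toRingHom.toAlgebra
    infer_instance
  let (f : M →ₐ[K] Ω) : Fintype (@AlgHom M L Ω _ _ _ _ f.toRingHom.toAlgebra) :=
    Fintype.ofFinite _
  rw [Fintype.sum_equiv (algHomEquivSigma (A := K) (B := M) (C := L) (D := Ω)) _
    (fun s => Point.map (W' := W) s.1 P'), Fintype.sum_sigma, Finset.smul_sum]
  · refine Finset.sum_congr rfl fun f _ => ?_
    simp only [Finset.sum_const, Finset.card_univ]
    rw [Fintype.card_eq_nat_card, hcard]
  · intro j
    rw [← hP, Point.map_map]
    rfl

end Conjugates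

/-! ### Properties of a function of minimal degree. -/

section MinimalFunction

open WeierstrassCurve.Affine

variable {K : Type u} [Field K] {W : WeierstrassCurve.Affine K}

lemma natDegree_polyR_zero (U : K[X]) : (polyR W U 0).natDegree = 2 * U.natDegree := by
  simp [polyR]

lemma natDegree_polyR_C_mul {c : K} (hc : c ≠ 0) (U V : K[X]) :
    (polyR W (C c * U) (C c * V)).natDegree = (polyR W U V).natDegree := by
  rw [polyR_mul, ← C_pow, natDegree_C_mul (pow_ne_zero 2 hc)]

/-- Among the pairs `(U, V)` for which `U(x) + V(x) y` vanishes, the pair `(U, V)` has minimal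
degree, and it is the only one of this degree up to scalars. -/
structure IsMinimalPair {L : Type v} [Field L] [Algebra K L] (W : WeierstrassCurve.Affine K)
    (x y : L) (U V : K[X]) : Prop where
  ne_zero : ofUV W U V ≠ 0
  vanishes : aeval x U + aeval x V * y = 0
  unique : ∀ U' V' : K[X], aeval x U' + aeval x V' * y = 0 →
    (polyR W U' V').natDegree ≤ (polyR W U V).natDegree → ∃ c : K, U' = C c * U ∧ V' = C c * V

variable {L : Type v} [Field L] [Algebra K L] {x y : L} {U V : K[X]}

lemma IsMinimalPair.natDegree_le (h : IsMinimalPair W x y U V) {U' V' : K[X]}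
    (hne : ofUV W U' V' ≠ 0) (h0 : aeval x U' + aeval x V' * y = 0) :
    (polyR W U V).natDegree ≤ (polyR W U' V').natDegree := by
  by_contra! hlt
  obtain ⟨c, rfl, rfl⟩ := h.unique U' V' h0 hlt.le
  have hc : c ≠ 0 := by
    rintro rfl
    exact hne ((ofUV_eq_zero_iff W _ _).2 (by simp))
  exact hlt.ne (natDegree_polyR_C_mul hc U V)

lemma aeval_polyR_eq_zero (hxy : (W⁄L).Equation x y) (h0 : aeval x U + aeval x V * y = 0) :
    aeval x (polyR W U V) = 0 := by
  have hU : aeval x U = -(aeval x V * y) := eq_neg_of_add_eq_zero_left h0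
  have h := ((W⁄L).equation_iff x y).1 hxy
  simp only [WeierstrassCurve.baseChange, WeierstrassCurve.map_a₁, WeierstrassCurve.map_a₂,
    WeierstrassCurve.map_a₃, WeierstrassCurve.map_a₄, WeierstrassCurve.map_a₆] at h
  simp only [polyR, map_add, map_sub, map_mul, map_pow, aeval_X, aeval_C, hU]
  linear_combination -(aeval x V) ^ 2 * h

/-- If `V(x₀) = 0` then also `U(x₀) = 0`, and dividing both by `X - x₀` gives a function that still
vanishes at the point, since `x ≠ x₀`, with degree smaller by `2`. -/
lemma IsMinimalPair.eval_ne_zero (h : IsMinimalPair W x y U V)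
    (hx : ∀ a : K, x ≠ algebraMap K L a) {x₀ : K} (h₀ : (polyR W U V).eval x₀ = 0) :
    V.eval x₀ ≠ 0 := by
  intro hV
  have hU : U.eval x₀ = 0 := by simpa [polyR, hV] using h₀
  obtain ⟨U', rfl⟩ := dvd_iff_isRoot.2 hU
  obtain ⟨V', rfl⟩ := dvd_iff_isRoot.2 hV
  have hne : ofUV W U' V' ≠ 0 := by
    intro h'
    obtain ⟨rfl, rfl⟩ := (ofUV_eq_zero_iff W _ _).1 h'
    exact h.ne_zero ((ofUV_eq_zero_iff W _ _).2 (by simp))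
  have h0 : aeval x U' + aeval x V' * y = 0 := by
    have := h.vanishes
    simp only [map_mul, map_sub, aeval_X, aeval_C] at this
    refine (mul_eq_zero.1 ?_).resolve_left (sub_ne_zero.2 (hx x₀))
    linear_combination this
  have hle := h.natDegree_le hne h0
  rw [polyR_mul, natDegree_mul (pow_ne_zero _ (X_sub_C_ne_zero _)) (polyR_ne_zero hne),
    natDegree_pow, natDegree_X_sub_C] at hle
  omega

variable [FiniteDimensional K L]

lemma exists_natDegree_polyR_le (x y : L) : ∃ U V : K[X], ofUV W U V ≠ 0 ∧
    aeval x U + aeval x V * y = 0 ∧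
    (polyR W U V).natDegree ≤ Module.finrank K (fieldOfDefinition K x y) + 1 := by
  have hx : x ∈ fieldOfDefinition K x y := IntermediateField.subset_adjoin _ _ (by simp)
  have hy : y ∈ fieldOfDefinition K x y := IntermediateField.subset_adjoin _ _ (by simp)
  -- Linear dependence is taken in `M`, not in `L`, so that the bound involves `δ` instead of `d`.
  set M := fieldOfDefinition K x y
  obtain ⟨Z, hZ, k, hk⟩ := Fintype.not_linearIndependent_iff.1 (mt
    (LinearIndependent.fintype_card_le_finrank (R := K)
      (b := fun k : Fin (Module.finrank K M + 1) => values (⟨x, hx⟩ : M) ⟨y, hy⟩ k)) (by simp))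
  rw [sum_smul_values] at hZ
  refine ⟨polyU Z, polyV Z, ?_, ?_, natDegree_polyR_polyU_polyV_le W Z⟩
  · intro h
    obtain ⟨hU, hV⟩ := (ofUV_eq_zero_iff W _ _).1 h
    rw [entry_eq_zero_of_polyU_polyV hU hV] at hk
    exact hk rfl
  · have := congrArg M.val hZ
    rw [map_add, map_mul, ← aeval_algHom_apply, ← aeval_algHom_apply, map_zero] at this
    exact this

lemma IsMinimalPair.natDegree_le_finrank (h : IsMinimalPair W x y U V) :
    (polyR W U V).natDegree ≤ Module.finrank K (fieldOfDefinition K x y) + 1 := by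
  obtain ⟨U', V', hne, h0, hdeg⟩ := exists_natDegree_polyR_le (W := W) x y
  exact (h.natDegree_le hne h0).trans hdeg

lemma natDegree_minpoly_dvd (x y : L) :
    (minpoly K x).natDegree ∣ Module.finrank K (fieldOfDefinition K x y) := by
  rw [← IntermediateField.adjoin.finrank (IsIntegral.of_finite K x)]
  exact IntermediateField.finrank_dvd_of_le_right
    (IntermediateField.adjoin.mono K _ _ (by simp))

lemma two_le_natDegree_minpoly (hx : ∀ a : K, x ≠ algebraMap K L a) :
    2 ≤ (minpoly K x).natDegree := by
  rw [minpoly.two_le_natDegree_iff (IsIntegral.of_finite K x)]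
  rintro ⟨a, rfl⟩
  exact hx a rfl

/-- Here `U` has the degree `m` of the minimal polynomial of `x`, which divides `δ`. An equality `2m
= δ + 1` would give `m ∣ 1`, whereas `m ≥ 2`. -/
lemma IsMinimalPair.natDegree_of_eq_zero (h : IsMinimalPair W x y U 0)
    (hx : ∀ a : K, x ≠ algebraMap K L a) :
    (polyR W U 0).natDegree ≠ Module.finrank K (fieldOfDefinition K x y) + 1 := by
  have hm0 : minpoly K x ≠ 0 := minpoly.ne_zero (IsIntegral.of_finite K x)
  have hU0 : aeval x U = 0 := by simpa using h.vanishes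
  have hU : U ≠ 0 := fun hU => h.ne_zero ((ofUV_eq_zero_iff W _ _).2 ⟨hU, rfl⟩)
  have hle : (minpoly K x).natDegree ≤ U.natDegree :=
    natDegree_le_of_dvd (minpoly.dvd K x hU0) hU
  have hge := h.natDegree_le (U' := minpoly K x) (V' := 0)
    (fun h => hm0 ((ofUV_eq_zero_iff W _ _).1 h).1) (by simp)
  rw [natDegree_polyR_zero, natDegree_polyR_zero] at hge
  have h2 := two_le_natDegree_minpoly hx
  obtain ⟨c, hc⟩ := natDegree_minpoly_dvd (K := K) x y
  rw [natDegree_polyR_zero, hc, show U.natDegree = (minpoly K x).natDegree by omega]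
  intro heq
  have h1 : (minpoly K x).natDegree ∣ 1 :=
    (Nat.dvd_add_right (dvd_mul_right _ c)).1 (heq ▸ dvd_mul_left _ 2)
  have := Nat.le_of_dvd one_pos h1
  omega

/-- Otherwise the minimal polynomial of `x` would divide `V` and would itself be a vanishing
function of smaller degree: `2 deg V < 2 deg V + 3`. -/
lemma IsMinimalPair.aeval_ne_zero (h : IsMinimalPair W x y U V) (hV : V ≠ 0) :
    aeval x V ≠ 0 := by
  intro hV0
  have hm0 : minpoly K x ≠ 0 := minpoly.ne_zero (IsIntegral.of_finite K x)
  have hle : (minpoly K x).natDegree ≤ V.natDegree :=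
    natDegree_le_of_dvd (minpoly.dvd K x hV0) hV
  have hge := h.natDegree_le (U' := minpoly K x) (V' := 0)
    (fun h => hm0 ((ofUV_eq_zero_iff W _ _).1 h).1) (by simp)
  rw [natDegree_polyR_zero] at hge
  have := ((natDegree_polyR_le_iff W).1 hge).2 V.natDegree (by omega)
  exact hV (leadingCoeff_eq_zero.1 this)

/-- Since `y = -U(x) / V(x)`, the field `K(x, y)` is just `K(x)`. -/
lemma IsMinimalPair.natDegree_minpoly (h : IsMinimalPair W x y U V) (hV : V ≠ 0) :
    (minpoly K x).natDegree = Module.finrank K (fieldOfDefinition K x y) := by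
  have hx : x ∈ IntermediateField.adjoin K {x} := IntermediateField.mem_adjoin_simple_self K x
  have haeval (p : K[X]) : aeval x p ∈ IntermediateField.adjoin K {x} :=
    IntermediateField.algebra_adjoin_le_adjoin K _ (aeval_mem_adjoin_singleton K x)
  have hy : y = -aeval x U / aeval x V := by
    rw [eq_div_iff (h.aeval_ne_zero hV)]
    linear_combination h.vanishes
  suffices hK : IntermediateField.adjoin K {x} = fieldOfDefinition K x y by
    rw [← IntermediateField.adjoin.finrank (IsIntegral.of_finite K x), hK]
  refine le_antisymm (IntermediateField.adjoin.mono K _ _ (by simp))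
    (IntermediateField.adjoin_le_iff.2 ?_)
  rintro z (rfl | rfl)
  · exact hx
  · rw [hy]
    exact div_mem (neg_mem (haeval U)) (haeval V)

end MinimalFunction

/-! ### The residual point, the trace, and the degenerate inputs. -/

section Correctness

open WeierstrassCurve.Affine

variable {K : Type u} [Field K] {W : WeierstrassCurve.Affine K}

lemma equation_of_eval_polyR_eq_zero {U V : K[X]} {x₀ : K} (hV : V.eval x₀ ≠ 0)
    (h : (polyR W U V).eval x₀ = 0) : (W⁄K).Equation x₀ (-U.eval x₀ / V.eval x₀) := by
  rw [equation_iff]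
  simp only [WeierstrassCurve.baseChange, WeierstrassCurve.map_a₁, WeierstrassCurve.map_a₂,
    WeierstrassCurve.map_a₃, WeierstrassCurve.map_a₄, WeierstrassCurve.map_a₆,
    Algebra.algebraMap_self, RingHom.id_apply]
  simp only [polyR, eval_add, eval_sub, eval_mul, eval_pow, eval_X, eval_C] at h
  field_simp
  linear_combination -h

lemma evalAt_ofUV {F : Type v} [Field F] [Algebra K F] {a b : F} (h : (W⁄F).Equation a b)
    (U V : K[X]) : evalAt W h (ofUV W U V) = aeval a U + aeval a V * b := by
  rw [evalAt, ofUV, AdjoinRoot.lift_mk]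
  simp [aeval_def]

variable [W.IsElliptic]

lemma affinePoint_eq_some {x₀ y₀ : K} (h : (W⁄K).Equation x₀ y₀) :
    affinePoint W x₀ y₀ = some (Point.mk h) := dif_pos h

/-- `Q` is the point determined by the linear quotient `S`. -/
structure IsResidualPoint (W : WeierstrassCurve.Affine K) [W.IsElliptic] (U V S : K[X])
    (Q : (W⁄K).Point) (x₀ : K) : Prop where
  isRoot_iff : ∀ x, S.IsRoot x ↔ x = x₀
  eval_ne_zero : V.eval x₀ ≠ 0
  affinePoint_eq : affinePoint W x₀ (-U.eval x₀ / V.eval x₀) = some Q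

variable {L : Type v} [Field L] [Algebra K L] [Algebra.IsSeparable K L] {x y : L} {U V : K[X]}
  {Ω : Type w} [Field Ω] [Algebra K Ω] [IsAlgClosed Ω]

lemma vanishesAt_conjugates_iff (hxy : (W⁄L).Equation x y) (U V : K[X]) :
    (∀ j : L →ₐ[K] Ω, VanishesAt W (ofUV W U V) (Point.map (W' := W) j (Point.mk hxy))) ↔
      aeval x U + aeval x V * y = 0 := by
  have key (j : L →ₐ[K] Ω) :
      VanishesAt W (ofUV W U V) (Point.map (W' := W) j (Point.mk hxy)) ↔
        aeval x U + aeval x V * y = 0 := by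
    have h1 : VanishesAt W (ofUV W U V) (Point.map (W' := W) j (Point.mk hxy)) ↔
        evalAt W ((W.baseChange_equation j.injective x y).2 hxy) (ofUV W U V) = 0 := Iff.rfl
    rw [h1, evalAt_ofUV, aeval_algHom_apply, aeval_algHom_apply, ← map_mul, ← map_add,
      map_eq_zero]
  exact ⟨fun h => (key IsAlgClosed.lift).1 (h _), fun h j => (key j).2 h⟩

variable [FiniteDimensional K L]

theorem IsMinimalPair.exists_trace (h : IsMinimalPair W x y U V)
    (hx : ∀ a : K, x ≠ algebraMap K L a) (hxy : (W⁄L).Equation x y)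
    {x' y' : fieldOfDefinition K x y} (hx' : (x' : L) = x) (hy' : (y' : L) = y)
    (h' : (W⁄(fieldOfDefinition K x y)).Nonsingular x' y') :
    ∃ Q : (W⁄K).Point,
      Point.map (W' := W) (Algebra.ofId K Ω) (-Q) =
        ∑ j : fieldOfDefinition K x y →ₐ[K] Ω, Point.map (W' := W) j (Point.some x' y' h') ∧
      (polyR W U V).natDegree = (if Q = 0 then Module.finrank K (fieldOfDefinition K x y)
        else Module.finrank K (fieldOfDefinition K x y) + 1) ∧
      (V = 0 → Q = 0) ∧
      (V ≠ 0 → minpoly K x ∣ polyR W U V ∧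
        ((polyR W U V / minpoly K x).degree = 0 ↔ Q = 0) ∧
        (Q ≠ 0 → (polyR W U V / minpoly K x).degree = 1 ∧
          ∃ x₀, IsResidualPoint W U V (polyR W U V / minpoly K x) Q x₀)) := by
  have hm : (minpoly K x).Monic := minpoly.monic (IsIntegral.of_finite K x)
  have hR : polyR W U V ≠ 0 := polyR_ne_zero h.ne_zero
  have hdvd : minpoly K x ∣ polyR W U V :=
    minpoly.dvd K x (aeval_polyR_eq_zero hxy h.vanishes)
  have hRS := EuclideanDomain.mul_div_cancel' hm.ne_zero hdvd
  obtain ⟨hge, hsum⟩ := finrank_le_natDegree_polyR (Ω := Ω) hx' hy' h' h.ne_zero h.vanishes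
  have hle := h.natDegree_le_finrank
  set δ := Module.finrank K (fieldOfDefinition K x y)
  set S := polyR W U V / minpoly K x
  have hS0 : S ≠ 0 := by
    rintro hS
    rw [hS, mul_zero] at hRS
    exact hR hRS.symm
  have hdegS (hV : V ≠ 0) : (polyR W U V).natDegree = δ + S.natDegree := by
    rw [← hRS, natDegree_mul hm.ne_zero hS0, h.natDegree_minpoly hV]
  -- Degree `δ` means that the conjugates are all the zeros and `Q = O`; otherwise the degree is `δ
  -- + 1` and one zero is left over.
  rcases hge.eq_or_lt with heq | hlt
  · refine ⟨0, ?_, by rw [if_pos rfl, heq], fun _ => rfl, fun hV => ⟨hdvd, ?_, fun h => absurd rfl h⟩⟩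
    · rw [hsum heq, neg_zero, map_zero]
    · have := hdegS hV
      rw [degree_eq_natDegree hS0]
      exact iff_of_true (by rw [show S.natDegree = 0 by omega]; rfl) rfl
  · have hdeg : (polyR W U V).natDegree = δ + 1 := by omega
    have hV : V ≠ 0 := by
      rintro rfl
      exact h.natDegree_of_eq_zero hx hdeg
    have hS1 : S.degree = 1 := by
      have := hdegS hV
      exact (degree_eq_iff_natDegree_eq_of_pos one_pos).2 (by omega)
    obtain ⟨x₀, hx₀⟩ := exists_root_of_degree_eq_one hS1
    have hroot (t : K) : S.IsRoot t ↔ t = x₀ := by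
      refine ⟨fun ht => ?_, fun ht => ht ▸ hx₀⟩
      by_contra hne
      have hcard := card_roots' S
      have hsub : ({t, x₀} : Finset K) ⊆ S.roots.toFinset := by
        intro z hz
        rw [Multiset.mem_toFinset, mem_roots hS0]
        rcases Finset.mem_insert.1 hz with rfl | hz
        · exact ht
        · rwa [Finset.mem_singleton.1 hz]
      have h1 := Finset.card_le_card hsub
      rw [Finset.card_pair hne] at h1
      have h2 := Multiset.toFinset_card_le S.roots
      have h3 : S.natDegree = 1 := natDegree_eq_of_degree_eq_some hS1
      omega
    have hR0 : (polyR W U V).eval x₀ = 0 := by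
      rw [← hRS, eval_mul, hx₀.eq_zero, mul_zero]
    have hV0 := h.eval_ne_zero hx hR0
    have heqn := equation_of_eval_polyR_eq_zero hV0 hR0
    have hQ0 : Point.mk heqn ≠ 0 := Point.some_ne_zero _
    refine ⟨Point.mk heqn, ?_, ?_, fun hV' => absurd hV' hV, fun _ => ⟨hdvd, ?_, fun _ =>
      ⟨hS1, x₀, hroot, hV0, affinePoint_eq_some heqn⟩⟩⟩
    · rw [map_neg, neg_eq_iff_add_eq_zero]
      exact sum_conjugates_add_eq_zero hx' hy' h' h.ne_zero h.vanishes
        (equation_iff_nonsingular.mp heqn) (hx x₀) (by field_simp; ring) hdeg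
    · rw [if_neg hQ0, hdeg]
    · rw [hS1]
      exact iff_of_false one_ne_zero hQ0

/-- `lastIndex Z` need be known only for `Q ≠ O`: if `Q = O`, the output is `O` before it is read.
-/
lemma finish_eq_some {d δ : ℕ} {Z : Fin (d + 1) → K} {m : K[X]} {Q : (W⁄K).Point} (hδ : δ ∣ d)
    (hlast : Q ≠ 0 → lastIndex Z = δ) (h0 : polyV Z = 0 → Q = 0)
    (hdvd : polyV Z ≠ 0 → m ∣ polyR W (polyU Z) (polyV Z))
    (hS : polyV Z ≠ 0 → ((polyR W (polyU Z) (polyV Z) / m).degree = 0 ↔ Q = 0))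
    (hQ : polyV Z ≠ 0 → Q ≠ 0 →
      ∃ x₀, IsResidualPoint W (polyU Z) (polyV Z) (polyR W (polyU Z) (polyV Z) / m) Q x₀) :
    finish W Z m = some ((-((d / δ : ℕ) : ℤ)) • Q) := by
  simp only [finish]
  split_ifs with hV hm hdeg hroot heval hd
  · rw [h0 hV, smul_zero]
  · rw [(hS hV).1 hdeg, smul_zero]
  all_goals
    try exact absurd (hdvd hV) hm
  -- In all remaining branches `S` is not a nonzero constant, so `Q ≠ O` and the residual point is
  -- available.
  all_goals
    have hQ0 : Q ≠ 0 := fun h => hdeg ((hS hV).2 h)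
    obtain ⟨x₀, hx₀⟩ := hQ hV hQ0
  · have := (hx₀.isRoot_iff _).1 hroot.choose_spec.1
    exact absurd (this ▸ heval) hx₀.eval_ne_zero
  · have := (hx₀.isRoot_iff _).1 hroot.choose_spec.1
    rw [this, hx₀.affinePoint_eq, hlast hQ0]
    rfl
  · exact absurd (hlast hQ0 ▸ hδ) hd
  · exact absurd ⟨x₀, (hx₀.isRoot_iff x₀).2 rfl, fun t ht => (hx₀.isRoot_iff t).1 ht⟩ hroot

lemma degree_sub_C_lt {T p : K[X]} (hT : Irreducible T) (hp : p.degree < T.degree) (a : K) :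
    (p - C a).degree < T.degree :=
  (degree_sub_le _ _).trans_lt (max_lt hp (degree_C_le.trans_lt (degree_pos_of_irreducible hT)))

lemma mk_ne_algebraMap {T p : K[X]} [hT : Fact (Irreducible T)] (hp : p.degree < T.degree)
    (hp0 : p.natDegree ≠ 0) (a : K) : AdjoinRoot.mk T p ≠ algebraMap K (AdjoinRoot T) a := by
  intro h
  rw [AdjoinRoot.algebraMap_eq, ← AdjoinRoot.mk_C, AdjoinRoot.mk_eq_mk] at h
  have := eq_zero_of_dvd_of_degree_lt h (degree_sub_C_lt hT.out hp a)
  rw [sub_eq_zero.1 this, natDegree_C] at hp0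
  exact hp0 rfl

lemma sum_conjugates_algebraMap {a b : K} (hab : (W⁄K).Equation a b) {P : (W⁄L).Point}
    (hP : Point.map (W' := W) (Algebra.ofId K L) (Point.mk hab) = P) :
    ∑ j : L →ₐ[K] Ω, Point.map (W' := W) j P = Point.map (W' := W) (Algebra.ofId K Ω)
      (Module.finrank K L • Point.mk hab) := by
  have h (j : L →ₐ[K] Ω) : Point.map (W' := W) j P =
      Point.map (W' := W) (Algebra.ofId K Ω) (Point.mk hab) := by
    rw [← hP, Point.map_map]
    congr 2
    exact Subsingleton.elim _ _
  rw [Finset.sum_congr rfl fun j _ => h j, Finset.sum_const, Finset.card_univ, AlgHom.card, map_nsmul]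

/-- The function `X - a` has degree `2` and vanishes at the conjugates, of which there are at least
two since `y ∉ K`. Hence they are all its zeros and sum to `O`. -/
lemma sum_conjugates_of_x_eq_algebraMap {a : K} (hx : x = algebraMap K L a)
    (hy : ∀ b : K, y ≠ algebraMap K L b) (hxy : (W⁄L).Equation x y) :
    ∑ j : L →ₐ[K] Ω, Point.map (W' := W) j (Point.mk hxy) = 0 := by
  obtain ⟨x', y', h', hx', hy', hP⟩ :=
    exists_point_fieldOfDefinition (equation_iff_nonsingular.mp hxy)
  have key := finrank_le_natDegree_polyR (Ω := Ω) (W := W) hx' hy' h' (U := X - C a) (V := 0)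
    (fun h => X_sub_C_ne_zero a ((ofUV_eq_zero_iff W _ _).1 h).1) (by simp [hx])
  rw [natDegree_polyR_zero, natDegree_X_sub_C] at key
  have hpos : 0 < Module.finrank K (fieldOfDefinition K x y) := Module.finrank_pos
  have hne : Module.finrank K (fieldOfDefinition K x y) ≠ 1 := by
    intro h1
    have hmem : y ∈ fieldOfDefinition K x y := IntermediateField.subset_adjoin _ _ (by simp)
    rw [IntermediateField.finrank_eq_one_iff.1 h1, IntermediateField.mem_bot] at hmem
    obtain ⟨b, hb⟩ := hmem
    exact hy b hb.symm
  have hsum := key.2 (by omega)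
  have := sum_map_eq_nsmul (Ω := Ω) hP
  rw [hsum, smul_zero] at this
  exact this

end Correctness

end EllTrace

/-! ### Assembly of the theorem. -/

theorem mainTheorem1 {K : Type*} [Field K] (W : WeierstrassCurve.Affine K) [W.IsElliptic]
    (T : K[X]) [Fact (Irreducible T)] (hTsep : T.Separable)
    (xP yP : K[X]) (hxP : xP.degree < T.degree) (hyP : yP.degree < T.degree)
    (hP : (W⁄(AdjoinRoot T)).Equation (AdjoinRoot.mk T xP) (AdjoinRoot.mk T yP)) :
    -- there is a correct subroutine for kernel matrices in echelon form
    (∃ kernel : EllTrace.KernelRoutine K, kernel.IsCorrect) ∧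
    ∀ (kernel : EllTrace.KernelRoutine K), kernel.IsCorrect →
    ∀ (Ω : Type*) [Field Ω] [Algebra K Ω] [IsAlgClosure K Ω],
    let P : (W⁄(AdjoinRoot T)).Point := WeierstrassCurve.Affine.Point.mk hP
    let d : ℕ := T.natDegree
    let KP := EllTrace.fieldOfDefinition K (AdjoinRoot.mk T xP) (AdjoinRoot.mk T yP)
    let dP : ℕ := Module.finrank K KP
    ∃ out : (W⁄K).Point,
      -- the algorithm succeeds and returns the trace
      EllTrace.ellTraceSep kernel W T xP yP = some out ∧
      EllTrace.IsTrace W (AdjoinRoot T) Ω P out ∧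
      -- what the main part of the algorithm computes
      (xP.natDegree ≠ 0 →
        ∃ (Z : Fin (d + 1) → K) (P' : (W⁄KP).Point) (Q : (W⁄K).Point),
          EllTrace.leftmostColumn (kernel _ _ (EllTrace.valueMatrix T xP yP)) = some Z ∧
          -- `Q` is minus the trace of `P` from its field of definition
          WeierstrassCurve.Affine.Point.map (W' := W) KP.val P' = P ∧
          EllTrace.IsTrace W KP Ω P' (-Q) ∧
          dP ∣ d ∧ out = (-((d / dP : ℕ) : ℤ)) • Q ∧
          let U := EllTrace.polyU Z
          let V := EllTrace.polyV Z
          let f := EllTrace.ofUV W U V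
          let m := minpoly K (AdjoinRoot.mk T xP)
          let R := EllTrace.polyR W U V
          let S := R / m
          -- `f` has minimal degree among the functions vanishing at the conjugates of `P`
          f ≠ 0 ∧ f ∈ EllTrace.riemannRochSpace W (d + 1) ∧
          (∀ j : AdjoinRoot T →ₐ[K] Ω,
            EllTrace.VanishesAt W f (WeierstrassCurve.Affine.Point.map (W' := W) j P)) ∧
          (∀ g : W.CoordinateRing, g ≠ 0 →
            (∀ j : AdjoinRoot T →ₐ[K] Ω,
              EllTrace.VanishesAt W g (WeierstrassCurve.Affine.Point.map (W' := W) j P)) →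
            EllTrace.functionDegree W f ≤ EllTrace.functionDegree W g ∧
            (EllTrace.functionDegree W f = EllTrace.functionDegree W g → ∃ c : K, g = c • f)) ∧
          EllTrace.functionDegree W f = (if Q = 0 then dP else dP + 1) ∧
          -- `R = - f * (f ∘ [-1])`
          algebraMap K[X] W.CoordinateRing R = -(f * EllTrace.compNeg W f) ∧
          -- `R` is divisible by the minimal polynomial, and the quotient gives `Q`
          (V = 0 → Q = 0) ∧
          (V ≠ 0 → m ∣ R ∧ (S.degree = 0 ↔ Q = 0) ∧
            (Q ≠ 0 → S.degree = 1 ∧ EllTrace.lastIndex Z = dP ∧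
              ∃ xQ : K, (∀ x, S.IsRoot x ↔ x = xQ) ∧ V.eval xQ ≠ 0 ∧
                EllTrace.affinePoint W xQ (-U.eval xQ / V.eval xQ) = some Q))) := by
  
  refine ⟨EllTrace.exists_isCorrect, fun kernel hkernel Ω _ _ _ => ?_⟩
  intro P d KP dP
  have hT : Irreducible T := Fact.out
  have : IsAlgClosed Ω := IsAlgClosure.isAlgClosed K
  have : Algebra.IsSeparable K (AdjoinRoot T) := EllTrace.isSeparable_adjoinRoot hTsep
  have : FiniteDimensional K (AdjoinRoot T) := (AdjoinRoot.powerBasis hT.ne_zero).finite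
  have hd : Module.finrank K (AdjoinRoot T) = d := by
    rw [(AdjoinRoot.powerBasis hT.ne_zero).finrank, AdjoinRoot.powerBasis_dim]
  have hxC (h : xP.natDegree = 0) : AdjoinRoot.mk T xP = algebraMap K _ (xP.coeff 0) := by
    conv_lhs => rw [eq_C_of_natDegree_eq_zero h]
    rw [AdjoinRoot.mk_C, AdjoinRoot.algebraMap_eq]
  have hyC (h : yP.natDegree = 0) : AdjoinRoot.mk T yP = algebraMap K _ (yP.coeff 0) := by
    conv_lhs => rw [eq_C_of_natDegree_eq_zero h]
    rw [AdjoinRoot.mk_C, AdjoinRoot.algebraMap_eq]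
  by_cases hx0 : xP.natDegree = 0
  · by_cases hy0 : yP.natDegree = 0
    · have hab : (W⁄K).Equation (xP.coeff 0) (yP.coeff 0) := by
        refine (W.baseChange_equation (f := Algebra.ofId K (AdjoinRoot T))
          (Algebra.ofId K (AdjoinRoot T)).injective _ _).1 ?_
        rw [Algebra.ofId_apply, Algebra.ofId_apply, ← hxC hx0, ← hyC hy0]
        exact hP
      refine ⟨d • WeierstrassCurve.Affine.Point.mk hab, ?_, ?_, fun h => absurd hx0 h⟩
      · rw [EllTrace.ellTraceSep, if_pos hx0, if_pos hy0, EllTrace.affinePoint_eq_some hab]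
        rfl
      · rw [EllTrace.isTrace_iff, EllTrace.sum_conjugates_algebraMap hab (P := P), hd]
        simp only [P, WeierstrassCurve.Affine.Point.mk, WeierstrassCurve.Affine.Point.map_some]
        congr 1
        · exact (hxC hx0).symm
        · exact (hyC hy0).symm
    · refine ⟨0, ?_, ?_, fun h => absurd hx0 h⟩
      · rw [EllTrace.ellTraceSep, if_pos hx0, if_neg hy0]
      · rw [EllTrace.isTrace_iff, map_zero, EllTrace.sum_conjugates_of_x_eq_algebraMap (hxC hx0)
          (EllTrace.mk_ne_algebraMap hyP hy0) hP]
  have hx := EllTrace.mk_ne_algebraMap hxP hx0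
  obtain ⟨Z, hZ, hker, b, hb, hlast, hmin⟩ :=
    EllTrace.leftmostColumn_eq_some (Nat.lt_succ_self _)
      (hkernel _ _ (EllTrace.valueMatrix T xP yP))
  have hZ0 : Z ≠ 0 := fun h => hb (by rw [h]; rfl)
  -- From here on the kernel matrix enters only through the minimality of this pair and the pole
  -- orders of its entries.
  have hpair : EllTrace.IsMinimalPair W (AdjoinRoot.mk T xP) (AdjoinRoot.mk T yP)
      (EllTrace.polyU Z) (EllTrace.polyV Z) :=
    ⟨fun h => hZ0 (EllTrace.entry_eq_zero_of_polyU_polyV ((EllTrace.ofUV_eq_zero_iff W _ _).1 h).1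
        ((EllTrace.ofUV_eq_zero_iff W _ _).1 h).2),
      (EllTrace.valueMatrix_mulVec_eq_zero_iff T xP yP Z).1 hker,
      fun U' V' h0 hdeg =>
        EllTrace.exists_eq_C_mul_of_natDegree_le W T xP yP hker hb hlast hmin h0 hdeg⟩
  obtain ⟨x', y', h', hx', hy', hP'⟩ := EllTrace.exists_point_fieldOfDefinition
    (WeierstrassCurve.Affine.equation_iff_nonsingular.mp hP)
  obtain ⟨Q, hQtr, hQdeg, hQV, hQS⟩ := hpair.exists_trace (Ω := Ω) hx hP hx' hy' h'
  have hdPpos : 0 < dP := Module.finrank_pos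
  have hdvd : dP ∣ d := hd ▸ ⟨_, (Module.finrank_mul_finrank K KP (AdjoinRoot T)).symm⟩
  have hlastIndex (hQ : Q ≠ 0) : EllTrace.lastIndex Z = dP :=
    EllTrace.lastIndex_eq W hdPpos (by rw [hQdeg, if_neg hQ])
  refine ⟨(-((d / dP : ℕ) : ℤ)) • Q, ?_, ?_, fun _ => ⟨Z, _, Q, hZ, hP', ?_, hdvd, rfl, ?_⟩⟩
  · rw [EllTrace.ellTraceSep, if_neg hx0, hZ, Option.bind_some]
    exact EllTrace.finish_eq_some hdvd hlastIndex hQV (fun hV => (hQS hV).1)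
      (fun hV => (hQS hV).2.1) (fun hV hQ => ((hQS hV).2.2 hQ).2)
  · rw [EllTrace.isTrace_iff, EllTrace.sum_map_eq_nsmul (P := P) hP', ← hQtr, hd, ← map_nsmul]
    congr 1
    rw [neg_smul, smul_neg, natCast_zsmul]
  · exact (EllTrace.isTrace_iff _ _).2 hQtr
  refine ⟨hpair.ne_zero, Or.inr ?_, ?_, ?_, ?_, EllTrace.algebraMap_polyR W _ _, hQV, ?_⟩
  · rw [EllTrace.functionDegree_ofUV]
    exact EllTrace.natDegree_polyR_polyU_polyV_le W Z
  · exact (EllTrace.vanishesAt_conjugates_iff hP _ _).2 hpair.vanishes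
  · intro g hg hgj
    obtain ⟨U', V', rfl⟩ := EllTrace.exists_ofUV_eq W g
    have h0 := (EllTrace.vanishesAt_conjugates_iff hP _ _).1 hgj
    rw [EllTrace.functionDegree_ofUV, EllTrace.functionDegree_ofUV]
    refine ⟨hpair.natDegree_le hg h0, fun heq => ?_⟩
    obtain ⟨c, rfl, rfl⟩ := hpair.unique U' V' h0 heq.ge
    exact ⟨c, EllTrace.ofUV_C_mul W c _ _⟩
  · rw [EllTrace.functionDegree_ofUV, hQdeg]
  · intro hV
    obtain ⟨h1, h2, h3⟩ := hQS hV
    refine ⟨h1, h2, fun hQ => ?_⟩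
    obtain ⟨hS, x₀, hx₀⟩ := h3 hQ
    exact ⟨hS, hlastIndex hQ, x₀, hx₀.isRoot_iff, hx₀.eval_ne_zero, hx₀.affinePoint_eq⟩
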